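/- Let $\mathbb T=\mathbb R/\mathbb Z$ with its quotient distance $d$, and let $T:\mathbb T\to\mathbb T$ be an orientation-preserving Lipschitz expanding map; that is, $T$ is Lipschitz, $T$ has degree $k\ge 2$, and there exist $\varepsilon>0$ and $K>1$ such that $d(x,y)<\varepsilon$ implies $d(T(x),T(y))\ge K\,d(x,y)$. A pre-image selector for $T$ is a map $\tau:\mathbb T\to\mathbb T$ with $T(\tau(x))=x$ for all $x$, having finitely many discontinuities, each of which is a jump discontinuity (the two one-sided limits exist and are distinct, and one of them is the value of $\tau$ there); a $1$-flower for $T$ is a set $F=\overline{\tau(\mathbb T)}$, where $\tau$ is a pre-image selector with exactly one discontinuity. A set $G\subset\mathbb T$ carries a measure $\mu$ if the topological support of $\mu$ is contained in $G$. A Sturmian measure is a $T$-invariant Borel probability measure carried by some $1$-flower. A $T$-invariant Borel probability measure $\mu$ is $f$-maximizing if $\int f\,d\mu=\max_m\int f\,dm$, the maximum being over all $T$-invariant Borel probability measures $m$. A function $f:\mathbb T\to\mathbb R$ can be Lipschitz flattened on $F$ if there is a Lipschitz function $\varphi:\mathbb T\to\mathbb R$ such that the restriction of $f+\varphi-\varphi\circ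 T$ to $F$ is constant. Theorem. Let $f:\mathbb T\to\mathbb R$ be Lipschitz. If a Sturmian measure $S$ is $f$-maximizing, then there exists a $1$-flower $F$ carrying $S$ such that $f$ can be Lipschitz flattened on $F$. -/

import Mathlib

open MeasureTheory Filter Topology

/-- The circle `ℝ / ℤ`, with its quotient metric `dist` and its Borel σ-algebra. -/
abbrev Circ : Type := UnitAddCircle

/-- `T` has degree `k`: it has a continuous lift `g : ℝ → ℝ` with `g (x + 1) = g x + k`. -/
def HasDegree (T : Circ → Circ) (k : ℤ) : Prop :=
  ∃ g : ℝ → ℝ, Continuous g ∧ (∀ x : ℝ, ((g x : ℝ) : Circ) = T (x : Circ)) ∧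
    ∀ x : ℝ, g (x + 1) = g x + k

/-- Expanding circle maps: continuous, and locally uniformly distance increasing. -/
def IsExpanding (T : Circ → Circ) : Prop :=
  Continuous T ∧ ∃ ε > (0 : ℝ), ∃ K > (1 : ℝ), ∀ x y : Circ,
    dist x y < ε → K * dist x y ≤ dist (T x) (T y)

/-- Orientation-preserving (for expanding maps): the degree is at least two. -/
def IsOrientationPreserving (T : Circ → Circ) : Prop :=
  ∃ k : ℤ, 2 ≤ k ∧ HasDegree T k

/-- Lipschitz continuity, with some constant. -/
def IsLip {X Y : Type*} [PseudoEMetricSpace X] [PseudoEMetricSpace Y] (h : X → Y) : Prop :=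
  ∃ C : NNReal, LipschitzWith C h

/-- `l` is the limit of `τ z` as `z` tends to `x` from the left
(with respect to the positive orientation). -/
def HasLeftLim (τ : Circ → Circ) (x l : Circ) : Prop :=
  Tendsto (fun t : ℝ => τ (x + (t : Circ))) (𝓝[<] (0 : ℝ)) (𝓝 l)

/-- `r` is the limit of `τ z` as `z` tends to `x` from the right. -/
def HasRightLim (τ : Circ → Circ) (x r : Circ) : Prop :=
  Tendsto (fun t : ℝ => τ (x + (t : Circ))) (𝓝[>] (0 : ℝ)) (𝓝 r)

/-- Jump discontinuity: both one-sided limits exist, they are distinct, and one of them is the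
value at the point. -/
def IsJumpDiscontinuity (τ : Circ → Circ) (x : Circ) : Prop :=
  ∃ l r : Circ, HasLeftLim τ x l ∧ HasRightLim τ x r ∧ l ≠ r ∧ (τ x = l ∨ τ x = r)

/-- The set of discontinuities. -/
def discontinuities (τ : Circ → Circ) : Set Circ := {x | ¬ ContinuousAt τ x}

/-- Pre-image selectors for `T`. -/
structure IsPreimageSelector (T τ : Circ → Circ) : Prop where
  apply_eq : ∀ x, T (τ x) = x
  finite_disc : (discontinuities τ).Finite
  jump : ∀ x ∈ discontinuities τ, IsJumpDiscontinuity τ x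

/-- `F` is a `p`-flower for `T`: the closure of the image of a pre-image selector which has exactly
`p ≥ 1` discontinuities. -/
def IsFlower (T : Circ → Circ) (p : ℕ) (F : Set Circ) : Prop :=
  1 ≤ p ∧ ∃ τ : Circ → Circ, IsPreimageSelector T τ ∧ (discontinuities τ).ncard = p ∧
    F = closure (Set.range τ)

/-- The set of `T`-invariant Borel probability measures. -/
def invariantMeasures (T : Circ → Circ) : Set (Measure Circ) :=
  {μ | IsProbabilityMeasure μ ∧ MeasurePreserving T μ μ}

/-- `G` carries `μ`: the topological support of `μ` is contained in `G`. -/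
def Carries (G : Set Circ) (μ : Measure Circ) : Prop := μ.support ⊆ G

/-- Sturmian measures: invariant probability measures carried by some `1`-flower. -/
def IsSturmian (T : Circ → Circ) (μ : Measure Circ) : Prop :=
  μ ∈ invariantMeasures T ∧ ∃ F : Set Circ, IsFlower T 1 F ∧ Carries F μ

/-- `μ` is `f`-maximizing: it attains the maximum of `∫ f dm` over invariant probability
measures `m`. -/
def IsMaximizing (T : Circ → Circ) (f : Circ → ℝ) (μ : Measure Circ) : Prop :=
  μ ∈ invariantMeasures T ∧ ∀ m ∈ invariantMeasures T, ∫ x, f x ∂m ≤ ∫ x, f x ∂μ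

/-- `h` is flat on `F`: its restriction to `F` is constant. -/
def IsFlatOn (h : Circ → ℝ) (F : Set Circ) : Prop := ∃ c : ℝ, ∀ x ∈ F, h x = c

/-- `f` can be Lipschitz flattened on `F`: `f + φ - φ ∘ T` is flat on `F` for some Lipschitz `φ`. -/
def CanBeLipschitzFlattened (T : Circ → Circ) (f : Circ → ℝ) (F : Set Circ) : Prop :=
  ∃ φ : Circ → ℝ, IsLip φ ∧ IsFlatOn (fun x => f x + φ x - φ (T x)) F

/-! ### The circle and its universal cover -/

/-! The map `T` lifts to an increasing homeomorphism `g` of the line, whose inverse `h` contracts by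
`1 / K`. A selector with one discontinuity follows a single branch of `h`, so its flower lies in the
projection of some `[h γ, h (γ + 1)]`, and every such arc is itself a flower (`exists_subset_arc`,
`isFlower_arc`). The problem is to choose `γ`.

A Lipschitz sub-action (`exists_normal_form`) replaces `f` by a cohomologous `F ≤ 0`, up to a
constant, with `F = 0` on `X`, the support of `S`. Flattening `F` on the arc of `γ` means finding a
1-periodic Lipschitz `φ` for which `φ x - F (h x) - φ (h x)` is constant on `[γ, γ + 1]`. A
contraction argument solves this for every `γ`, but only with `φ (x + 1) = φ x + φ 1`
(`exists_isQuasiSolution`); the obstruction is the number `φ 1`.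

The arc can slide over a parameter interval `[γ₁, γ₂]` without losing `X`, until an end point meets
`X` (`exists_arc_range`). At `γ₂` the right-continuous branch preserves `X`. Following it backwards
from a point of `X`, the base point always sees `F = 0` and any point to its right sees `F ≤ 0`,
while the two converge; hence `φ 1 ≤ 0` (`one_nonpos`). The mirror image gives `φ 1 ≥ 0` at `γ₁`
(`one_nonneg`). By compactness and connectedness some intermediate `γ` admits solutions of both
signs, and a convex combination has `φ 1 = 0` (`exists_periodic_solution`). -/

theorem circ_coe_eq_coe_iff {x y : ℝ} : (x : Circ) = (y : Circ) ↔ ∃ n : ℤ, y = x + n := by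
  rw [eq_comm, ← sub_eq_zero, ← AddCircle.coe_sub, AddCircle.coe_eq_zero_iff]
  refine exists_congr fun n => ?_
  rw [zsmul_eq_mul, mul_one]
  constructor <;> intro h <;> linarith

theorem circ_coe_add_int (x : ℝ) (n : ℤ) : ((x + n : ℝ) : Circ) = (x : Circ) :=
  (circ_coe_eq_coe_iff.2 ⟨n, rfl⟩).symm

theorem circ_coe_add_one (x : ℝ) : ((x + 1 : ℝ) : Circ) = (x : Circ) := by
  exact_mod_cast circ_coe_add_int x 1

theorem circ_continuous_coe : Continuous (fun x : ℝ => (x : Circ)) :=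
  AddCircle.continuous_mk' 1

theorem circ_dist_coe (x y : ℝ) : dist (x : Circ) (y : Circ) = |x - y - round (x - y)| := by
  rw [dist_eq_norm, ← AddCircle.coe_sub, UnitAddCircle.norm_eq]

theorem circ_dist_coe_le (x y : ℝ) : dist (x : Circ) (y : Circ) ≤ |x - y| := by
  rw [circ_dist_coe]
  simpa using round_le (x - y) 0

theorem circ_dist_coe_eq {x y : ℝ} (h : |x - y| ≤ 1 / 2) :
    dist (x : Circ) (y : Circ) = |x - y| := by
  rw [dist_eq_norm, ← AddCircle.coe_sub, AddCircle.norm_coe_eq_abs_iff _ one_ne_zero]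
  simpa using h

theorem circ_exists_coe (q : Circ) : ∃ y : ℝ, (y : Circ) = q :=
  QuotientAddGroup.mk_surjective q

theorem circ_exists_lift_dist (x : ℝ) (q : Circ) :
    ∃ y : ℝ, (y : Circ) = q ∧ |x - y| = dist (x : Circ) q := by
  obtain ⟨y, rfl⟩ := circ_exists_coe q
  refine ⟨y + round (x - y), circ_coe_add_int _ _, ?_⟩
  rw [circ_dist_coe, ← sub_sub]

theorem circ_exists_mem_Ico (γ x : ℝ) : ∃ n : ℤ, γ ≤ x + n ∧ x + n < γ + 1 := by
  refine ⟨-⌊x - γ⌋, ?_, ?_⟩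
  · have := Int.floor_le (x - γ)
    push_cast
    linarith
  · have := Int.lt_floor_add_one (x - γ)
    push_cast
    linarith

/-! ### Expanding lifts -/

theorem mul_sub_le_of_local {g : ℝ → ℝ} {A δ : ℝ} (hδ : 0 < δ)
    (h : ∀ x t, 0 < t → t < δ → A * t ≤ g (x + t) - g x) {x y : ℝ} (hxy : x ≤ y) :
    A * (y - x) ≤ g y - g x := by
  rcases hxy.eq_or_lt with rfl | hlt
  · simp
  obtain ⟨n, hn⟩ := exists_nat_gt ((y - x) / δ)
  have hn0 : (0 : ℝ) < n := lt_of_le_of_lt (by have := sub_pos.2 hlt; positivity) hn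
  set t := (y - x) / n with ht
  have ht0 : 0 < t := div_pos (sub_pos.2 hlt) hn0
  have htδ : t < δ := by
    rw [ht, div_lt_iff₀ hn0]
    rwa [div_lt_iff₀ hδ, mul_comm] at hn
  have key : ∀ m : ℕ, A * (m * t) ≤ g (x + m * t) - g x := by
    intro m
    induction m with
    | zero => simp
    | succ m ih =>
      have := h (x + m * t) t ht0 htδ
      have e : x + (m + 1 : ℕ) * t = x + m * t + t := by push_cast; ring
      rw [e]
      push_cast
      linarith
  have := key n
  have e : (n : ℝ) * t = y - x := by rw [ht]; field_simp
  rw [e] at this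
  simpa using this

/-- `g` is a lift of `T` to the real line, increasing distances by a factor of at least `K > 1`,
of degree `k`, and `h` is the inverse of `g`. -/
structure ExpandingLift (T : Circ → Circ) (g h : ℝ → ℝ) (K : ℝ) (k : ℤ) : Prop where
  one_lt : 1 < K
  two_le : 2 ≤ k
  coe_g : ∀ x, ((g x : ℝ) : Circ) = T (x : Circ)
  g_add_one : ∀ x, g (x + 1) = g x + k
  g_h : ∀ x, g (h x) = x
  h_g : ∀ x, h (g x) = x
  le_g : ∀ x y, x ≤ y → K * (y - x) ≤ g y - g x
  g_le : ∃ C : ℝ, ∀ x y, x ≤ y → g y - g x ≤ C * (y - x)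

/-- Otherwise the displacement would equal `1 / 2` exactly at some `s ≤ t`; there it is the circle
distance of the images, which the Lipschitz bound keeps below `1 / 2`. -/
theorem abs_lift_sub_lt {T : Circ → Circ} {g : ℝ → ℝ} (hg : Continuous g)
    (hgT : ∀ x : ℝ, ((g x : ℝ) : Circ) = T (x : Circ)) {C : ℝ}
    (hC : ∀ x y : Circ, dist (T x) (T y) ≤ C * dist x y) (hC0 : 0 ≤ C) {t : ℝ} (ht0 : 0 ≤ t)
    (ht : C * t < 1 / 2) (x : ℝ) : |g (x + t) - g x| < 1 / 2 := by
  by_contra! hcon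
  have hc : ContinuousOn (fun s => |g (x + s) - g x|) (Set.Icc 0 t) := by fun_prop
  have := intermediate_value_Icc ht0 hc
  obtain ⟨s, hs, hs'⟩ := this ⟨by simp, hcon⟩
  have h1 : dist (T ((x + s : ℝ) : Circ)) (T (x : Circ)) = 1 / 2 := by
    rw [← hgT, ← hgT, circ_dist_coe_eq hs'.le]
    exact hs'
  have h2 := hC ((x + s : ℝ) : Circ) (x : Circ)
  have h3 := circ_dist_coe_le (x + s) x
  rw [add_sub_cancel_left, abs_of_nonneg hs.1] at h3
  have h4 : C * dist ((x + s : ℝ) : Circ) (x : Circ) ≤ C * t :=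
    mul_le_mul_of_nonneg_left (h3.trans hs.2) hC0
  linarith

theorem exists_expandingLift {T : Circ → Circ} (hT : IsExpanding T)
    (hTor : IsOrientationPreserving T) (hTLip : IsLip T) :
    ∃ g h K k, ExpandingLift T g h K k := by
  obtain ⟨-, ε, hε, K, hK, hexp⟩ := hT
  obtain ⟨k, hk, g, hg, hgT, hgk⟩ := hTor
  obtain ⟨C, hC⟩ := hTLip
  have hC' : ∀ x y : Circ, dist (T x) (T y) ≤ C * dist x y := fun x y => hC.dist_le_mul x y
  -- Below this scale the expansion hypothesis applies, and circle distances of points and of their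
  -- images equal distances of lifts.
  obtain ⟨δ, hδ, hδε, hδ2, hδC⟩ : ∃ δ : ℝ, 0 < δ ∧ δ ≤ ε ∧ δ ≤ 1 / 2 ∧ C * δ < 1 / 2 := by
    refine ⟨min (min ε (1 / 2)) (1 / (2 * (C + 1))), by positivity,
      (min_le_left _ _).trans (min_le_left _ _), (min_le_left _ _).trans (min_le_right _ _), ?_⟩
    have h1 : min (min ε (1 / 2)) (1 / (2 * ((C : ℝ) + 1))) ≤ 1 / (2 * (C + 1)) :=
      min_le_right _ _
    have hC0 : (0 : ℝ) ≤ C := C.2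
    calc (C : ℝ) * _ ≤ C * (1 / (2 * (C + 1))) := mul_le_mul_of_nonneg_left h1 hC0
      _ < 1 / 2 := by
        rw [mul_one_div, div_lt_div_iff₀ (by positivity) (by positivity)]
        linarith
  have hsmall : ∀ x t, 0 < t → t < δ → |g (x + t) - g x| < 1 / 2 := by
    intro x t ht0 ht
    refine abs_lift_sub_lt hg hgT hC' C.2 ht0.le ?_ x
    have : (C : ℝ) * t ≤ C * δ := mul_le_mul_of_nonneg_left ht.le C.2
    linarith
  have hdist : ∀ x t, 0 < t → t < δ →
      dist (T ((x + t : ℝ) : Circ)) (T (x : Circ)) = |g (x + t) - g x| ∧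
      dist ((x + t : ℝ) : Circ) (x : Circ) = t := by
    intro x t ht0 ht
    constructor
    · rw [← hgT, ← hgT, circ_dist_coe_eq (hsmall x t ht0 ht).le]
    · rw [circ_dist_coe_eq] <;> rw [add_sub_cancel_left, abs_of_pos ht0]
      linarith
  have hlow : ∀ x t, 0 < t → t < δ → K * t ≤ |g (x + t) - g x| := by
    intro x t ht0 ht
    obtain ⟨h1, h2⟩ := hdist x t ht0 ht
    have := hexp ((x + t : ℝ) : Circ) (x : Circ) (by rw [h2]; linarith)
    rwa [h1, h2] at this
  have hup : ∀ x t, 0 < t → t < δ → |g (x + t) - g x| ≤ C * t := by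
    intro x t ht0 ht
    obtain ⟨h1, h2⟩ := hdist x t ht0 ht
    have := hC' ((x + t : ℝ) : Circ) (x : Circ)
    rwa [h1, h2] at this
  have hne : ∀ x t, 0 < t → t < δ → g (x + t) - g x ≠ 0 := by
    intro x t ht0 ht h0
    have := hlow x t ht0 ht
    rw [h0, abs_zero] at this
    nlinarith
  have hadd : ∀ (x : ℝ) (n : ℕ), g (x + n) = g x + n * k := by
    intro x n
    induction n with
    | zero => simp
    | succ n ih =>
      push_cast
      rw [← add_assoc, hgk, ih]
      ring
  -- The increment never vanishes on the connected strip `ℝ × (0, δ)`, so its sign is constant; a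
  -- negative sign would contradict the positive degree.
  have hpos : ∀ x t, 0 < t → t < δ → 0 < g (x + t) - g x := by
    by_contra! hcon
    obtain ⟨x₀, t₀, ht₀, ht₀δ, hx₀⟩ := hcon
    have hpre : IsPreconnected (Set.univ ×ˢ Set.Ioo 0 δ : Set (ℝ × ℝ)) :=
      isPreconnected_univ.prod isPreconnected_Ioo
    have hcont : ContinuousOn (fun p : ℝ × ℝ => g (p.1 + p.2) - g p.1)
        (Set.univ ×ˢ Set.Ioo 0 δ : Set (ℝ × ℝ)) := by fun_prop
    have hneg : ∀ x t, 0 < t → t < δ → g (x + t) - g x ≤ 0 := by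
      intro x t ht htδ
      by_contra! hxt
      have := hpre.intermediate_value (a := (x₀, t₀)) (b := (x, t)) ⟨trivial, ht₀, ht₀δ⟩
        ⟨trivial, ht, htδ⟩ hcont
      obtain ⟨p, hp, hp0⟩ := this ⟨hx₀, hxt.le⟩
      exact hne p.1 p.2 hp.2.1 hp.2.2 hp0
    have h1 := mul_sub_le_of_local (g := fun x => - g x) (A := 0) hδ
      (fun x t ht htδ => by have := hneg x t ht htδ; linarith)
      (show (0 : ℝ) ≤ 0 + 1 by norm_num)
    have h2 := hgk 0
    have hk' : (2 : ℝ) ≤ k := by exact_mod_cast hk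
    linarith
  have hle : ∀ x y, x ≤ y → K * (y - x) ≤ g y - g x := fun x y hxy =>
    mul_sub_le_of_local hδ (fun x t ht htδ => by
      have := hlow x t ht htδ
      rwa [abs_of_pos (hpos x t ht htδ)] at this) hxy
  have hge : ∀ x y, x ≤ y → g y - g x ≤ C * (y - x) := fun x y hxy => by
    have := mul_sub_le_of_local (g := fun x => - g x) (A := -C) hδ (fun x t ht htδ => by
      have := hup x t ht htδ
      rw [abs_of_pos (hpos x t ht htδ)] at this
      linarith) hxy
    linarith
  have hinj : Function.Injective g := by
    intro x y hxy
    rcases le_total x y with h | h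
    · have := hle x y h; nlinarith
    · have := hle y x h; nlinarith
  have hsurj : Function.Surjective g := by
    refine hg.surjective ?_ ?_
    · refine tendsto_atTop_mono' _ ?_ (tendsto_atTop_add_const_right _ (g 0) tendsto_id)
      filter_upwards [eventually_ge_atTop 0] with y hy
      have := hle 0 y hy
      simp only [id]
      nlinarith
    · refine tendsto_atBot_mono' _ ?_ (tendsto_atBot_add_const_right _ (g 0) tendsto_id)
      filter_upwards [eventually_le_atBot 0] with y hy
      have := hle y 0 hy
      simp only [id]
      nlinarith
  exact ⟨g, Function.surjInv hsurj, K, k, hK, hk, hgT, hgk, Function.surjInv_eq hsurj,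
    Function.leftInverse_surjInv ⟨hinj, hsurj⟩, hle, C, hge⟩

namespace ExpandingLift

variable {T : Circ → Circ} {g h : ℝ → ℝ} {K : ℝ} {k : ℤ}

theorem pos (H : ExpandingLift T g h K k) : 0 < K := zero_lt_one.trans H.one_lt

theorem g_add_int (H : ExpandingLift T g h K k) (x : ℝ) (n : ℤ) : g (x + n) = g x + n * k := by
  induction n with
  | zero => simp
  | succ n ih =>
    push_cast at ih ⊢
    rw [← add_assoc, H.g_add_one, ih]
    ring
  | pred n ih =>
    have := H.g_add_one (x + (-n - 1))
    push_cast at ih ⊢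
    rw [show x + (-(n : ℝ) - 1) + 1 = x + -n by ring, ih] at this
    linarith

theorem h_add_mul (H : ExpandingLift T g h K k) (x : ℝ) (n : ℤ) : h (x + n * k) = h x + n := by
  rw [← H.h_g (h x + n), H.g_add_int, H.g_h]

theorem strictMono_g (H : ExpandingLift T g h K k) : StrictMono g := by
  intro x y hxy
  have := H.le_g x y hxy.le
  have := mul_pos H.pos (sub_pos.2 hxy)
  linarith

theorem strictMono_h (H : ExpandingLift T g h K k) : StrictMono h := by
  intro x y hxy
  rw [← H.strictMono_g.lt_iff_lt, H.g_h, H.g_h]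
  exact hxy

theorem h_sub_le (H : ExpandingLift T g h K k) {x y : ℝ} (hxy : x ≤ y) :
    h y - h x ≤ (y - x) / K := by
  rw [le_div_iff₀ H.pos, mul_comm]
  simpa [H.g_h] using H.le_g _ _ (H.strictMono_h.monotone hxy)

theorem abs_h_sub_le (H : ExpandingLift T g h K k) (x y : ℝ) : |h x - h y| ≤ |x - y| / K := by
  rcases le_total y x with hxy | hxy
  · rw [abs_of_nonneg (sub_nonneg.2 hxy),
      abs_of_nonneg (sub_nonneg.2 (H.strictMono_h.monotone hxy))]
    exact H.h_sub_le hxy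
  · rw [abs_sub_comm, abs_sub_comm x, abs_of_nonneg (sub_nonneg.2 hxy),
      abs_of_nonneg (sub_nonneg.2 (H.strictMono_h.monotone hxy))]
    exact H.h_sub_le hxy

theorem continuous_h (H : ExpandingLift T g h K k) : Continuous h := by
  have : LipschitzWith (Real.toNNReal K⁻¹) h := by
    refine LipschitzWith.of_dist_le_mul fun x y => ?_
    rw [Real.dist_eq, Real.dist_eq, Real.coe_toNNReal _ (inv_nonneg.2 H.pos.le), inv_mul_eq_div]
    exact H.abs_h_sub_le x y
  exact this.continuous

theorem T_coe_h (H : ExpandingLift T g h K k) (x : ℝ) : T (h x : Circ) = (x : Circ) := by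
  rw [← H.coe_g, H.g_h]

theorem h_one_sub_lt (H : ExpandingLift T g h K k) (γ : ℝ) : h (γ + 1) - h γ < 1 := by
  have := H.h_sub_le (show γ ≤ γ + 1 by linarith)
  have h2 : (γ + 1 - γ) / K < 1 := by
    rw [div_lt_one H.pos]; linarith [H.one_lt]
  linarith

theorem exists_abs_g_le (H : ExpandingLift T g h K k) :
    ∃ C : ℝ, 0 ≤ C ∧ ∀ x y, |g x - g y| ≤ C * |x - y| := by
  obtain ⟨C, hC⟩ := H.g_le
  refine ⟨C, ?_, fun x y => ?_⟩
  · have h1 := hC 0 1 zero_le_one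
    have h2 := H.strictMono_g zero_lt_one
    linarith
  · rcases le_total y x with hxy | hxy
    · rw [abs_of_nonneg (sub_nonneg.2 hxy),
        abs_of_nonneg (sub_nonneg.2 (H.strictMono_g.monotone hxy))]
      exact hC _ _ hxy
    · rw [abs_sub_comm, abs_sub_comm x, abs_of_nonneg (sub_nonneg.2 hxy),
        abs_of_nonneg (sub_nonneg.2 (H.strictMono_g.monotone hxy))]
      exact hC _ _ hxy

end ExpandingLift

/-! ### One-flowers are arcs -/

namespace ExpandingLift

variable {T : Circ → Circ} {g h : ℝ → ℝ} {K : ℝ} {k : ℤ}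

theorem exists_eq_coe_h (H : ExpandingLift T g h K k) {x : ℝ} {q : Circ} (hq : T q = x) :
    ∃ j : ℤ, q = (h (x + j) : Circ) := by
  obtain ⟨u, rfl⟩ := circ_exists_coe q
  rw [← H.coe_g] at hq
  obtain ⟨n, hn⟩ := circ_coe_eq_coe_iff.1 hq.symm
  exact ⟨n, by rw [← hn, H.h_g]⟩

/-- Lifts of two points with the same image have `g`-values differing by an integer, which is `0`
when the lifts are close. -/
theorem exists_locally_injective (H : ExpandingLift T g h K k) :
    ∃ δ > 0, ∀ p q : Circ, T p = T q → dist p q < δ → p = q := by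
  obtain ⟨C, hC0, hC⟩ := H.exists_abs_g_le
  refine ⟨1 / (C + 1), by positivity, fun p q hpq hd => ?_⟩
  obtain ⟨u, rfl⟩ := circ_exists_coe p
  obtain ⟨v, rfl⟩ := circ_exists_coe q
  obtain ⟨w, hw, huw⟩ := circ_exists_lift_dist u v
  rw [← hw] at hpq ⊢
  rw [← H.coe_g, ← H.coe_g] at hpq
  obtain ⟨n, hn⟩ := circ_coe_eq_coe_iff.1 hpq
  have h1 := hC w u
  rw [hn, add_sub_cancel_left, abs_sub_comm, huw] at h1
  have h2 : |(n : ℝ)| < 1 := by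
    rw [lt_div_iff₀ (by positivity)] at hd
    nlinarith [@dist_nonneg _ _ (u : Circ) (v : Circ)]
  have h3 : n = 0 := by
    rw [← Int.abs_lt_one_iff]
    exact_mod_cast h2
  rw [h3, Int.cast_zero, add_zero] at hn
  rw [H.strictMono_g.injective hn]

/-- The set where `τ` agrees with a given branch is relatively closed by continuity and open by
local injectivity of `T`; the branch is fixed by the value at the midpoint. -/
theorem exists_branch (H : ExpandingLift T g h K k) {τ : Circ → Circ} (hτ : ∀ x, T (τ x) = x)
    {γ : ℝ} (hc : ∀ x ∈ Set.Ioo γ (γ + 1), ContinuousAt τ (x : Circ)) :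
    ∃ j : ℤ, ∀ x ∈ Set.Ioo γ (γ + 1), τ (x : Circ) = (h (x + j) : Circ) := by
  obtain ⟨δ, hδ, hinj⟩ := H.exists_locally_injective
  have hcτ : ∀ x ∈ Set.Ioo γ (γ + 1), ContinuousAt (fun z : ℝ => τ (z : Circ)) x :=
    fun x hx => (hc x hx).comp (f := fun z : ℝ => (z : Circ)) circ_continuous_coe.continuousAt
  have hch : ∀ j : ℤ, Continuous (fun z : ℝ => (h (z + j) : Circ)) := fun j =>
    circ_continuous_coe.comp (H.continuous_h.comp (by fun_prop))
  obtain ⟨j, hj⟩ := H.exists_eq_coe_h (hτ ((γ + 1 / 2 : ℝ) : Circ))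
  refine ⟨j, fun x hx => ?_⟩
  have hsub := isPreconnected_Ioo.subset_of_closure_inter_subset (s := Set.Ioo γ (γ + 1))
    (u := {x | x ∈ Set.Ioo γ (γ + 1) ∧ τ (x : Circ) = (h (x + j) : Circ)}) ?_ ?_ ?_
  · exact (hsub hx).2
  · rw [isOpen_iff_mem_nhds]
    rintro x ⟨hx, hxj⟩
    have h1 : Tendsto (fun z : ℝ => dist (τ (z : Circ)) (h (z + j) : Circ)) (𝓝 x) (𝓝 0) := by
      have := (hcτ x hx).tendsto.dist (hch j).continuousAt.tendsto
      rwa [hxj, dist_self] at this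
    filter_upwards [isOpen_Ioo.mem_nhds hx, h1.eventually (gt_mem_nhds hδ)] with z hz hzδ
    refine ⟨hz, hinj _ _ ?_ hzδ⟩
    rw [hτ, H.T_coe_h, circ_coe_add_int]
  · have hmem : γ + 1 / 2 ∈ Set.Ioo γ (γ + 1) := by constructor <;> linarith
    exact ⟨γ + 1 / 2, hmem, hmem, hj⟩
  · rintro x ⟨hxc, hx⟩
    refine ⟨hx, tendsto_nhds_unique_of_frequently_eq (hcτ x hx).tendsto
      (hch j).continuousAt.tendsto ?_⟩
    exact (mem_closure_iff_frequently.1 hxc).mono fun z hz => hz.2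

theorem isCompact_arc (a b : ℝ) : IsCompact ((fun x : ℝ => (x : Circ)) '' Set.Icc a b) :=
  isCompact_Icc.image circ_continuous_coe

theorem exists_subset_arc (H : ExpandingLift T g h K k) {F : Set Circ} (hF : IsFlower T 1 F) :
    ∃ γ : ℝ, F ⊆ (fun x : ℝ => (x : Circ)) '' Set.Icc (h γ) (h (γ + 1)) := by
  obtain ⟨-, τ, hτ, hcard, rfl⟩ := hF
  obtain ⟨p, hp⟩ := Set.ncard_eq_one.1 hcard
  obtain ⟨γ₀, rfl⟩ := circ_exists_coe p
  have hdisc : ∀ x : Circ, x ≠ (γ₀ : Circ) → ContinuousAt τ x := by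
    intro x hx
    by_contra hcon
    have : x ∈ discontinuities τ := hcon
    rw [hp] at this
    exact hx this
  have hne : ∀ x ∈ Set.Ioo γ₀ (γ₀ + 1), (x : Circ) ≠ (γ₀ : Circ) := by
    intro x hx heq
    obtain ⟨n, hn⟩ := circ_coe_eq_coe_iff.1 heq.symm
    have h1 : (0 : ℝ) < n := by linarith [hx.1]
    have h2 : (n : ℝ) < 1 := by linarith [hx.2]
    have h1' : 0 < n := by exact_mod_cast h1
    have h2' : n < 1 := by exact_mod_cast h2
    omega
  obtain ⟨j, hj⟩ := H.exists_branch hτ.apply_eq (γ := γ₀) fun x hx => hdisc _ (hne x hx)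
  have hmem : ∀ x ∈ Set.Ioo γ₀ (γ₀ + 1), τ (x : Circ) ∈
      (fun x : ℝ => (x : Circ)) '' Set.Icc (h (γ₀ + j)) (h (γ₀ + j + 1)) := by
    intro x hx
    refine ⟨h (x + j), ⟨H.strictMono_h.monotone ?_, H.strictMono_h.monotone ?_⟩, (hj x hx).symm⟩
    · linarith [hx.1]
    · linarith [hx.2]
  refine ⟨γ₀ + j, closure_minimal ?_ (isCompact_arc _ _).isClosed⟩
  rintro _ ⟨x, rfl⟩
  by_cases hx : x = (γ₀ : Circ)
  · subst hx
    -- At the discontinuity the value is a one-sided limit of values already in the closed arc.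
    obtain ⟨l, r, hl, hr, -, hlr⟩ := hτ.jump (γ₀ : Circ) (by rw [hp]; rfl)
    rcases hlr with hlr | hlr <;> rw [hlr]
    · refine (isCompact_arc _ _).isClosed.mem_of_tendsto hl ?_
      filter_upwards [Ioo_mem_nhdsLT (show (-1 : ℝ) < 0 by norm_num)] with t ht
      rw [← AddCircle.coe_add, ← circ_coe_add_one]
      exact hmem _ ⟨by linarith [ht.1], by linarith [ht.2]⟩
    · refine (isCompact_arc _ _).isClosed.mem_of_tendsto hr ?_
      filter_upwards [Ioo_mem_nhdsGT (show (0 : ℝ) < 1 by norm_num)] with t ht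
      rw [← AddCircle.coe_add]
      exact hmem _ ⟨by linarith [ht.1], by linarith [ht.2]⟩
  · obtain ⟨y, rfl⟩ := circ_exists_coe x
    obtain ⟨n, hn1, hn2⟩ := circ_exists_mem_Ico γ₀ y
    rw [← circ_coe_add_int y n] at hx ⊢
    exact hmem _ ⟨lt_of_le_of_ne hn1 fun heq => hx (by rw [heq]), hn2⟩

/-- The right-continuous selector whose only discontinuity is at `γ`. -/
noncomputable def selector (h : ℝ → ℝ) (γ : ℝ) (x : Circ) : Circ :=
  (h (AddCircle.equivIco 1 γ x) : Circ)

theorem selector_coe (h : ℝ → ℝ) {γ x : ℝ} (hx : x ∈ Set.Ico γ (γ + 1)) :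
    selector h γ (x : Circ) = (h x : Circ) := by
  rw [selector, AddCircle.equivIco_coe_of_mem hx]

theorem T_selector (H : ExpandingLift T g h K k) (γ : ℝ) (x : Circ) :
    T (selector h γ x) = x := by
  rw [selector, H.T_coe_h, AddCircle.coe_equivIco]

theorem hasRightLim_selector (H : ExpandingLift T g h K k) (γ : ℝ) :
    HasRightLim (selector h γ) γ (h γ) := by
  have h1 : Tendsto (fun t : ℝ => (h (γ + t) : Circ)) (𝓝[>] (0 : ℝ)) (𝓝 (h (γ + 0) : Circ)) :=
    ((circ_continuous_coe.comp (H.continuous_h.comp (by fun_prop))).tendsto 0).mono_left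
      nhdsWithin_le_nhds
  rw [add_zero] at h1
  refine h1.congr' ?_
  filter_upwards [Ioo_mem_nhdsGT (show (0 : ℝ) < 1 by norm_num)] with t ht
  rw [← AddCircle.coe_add, selector_coe h ⟨by linarith [ht.1], by linarith [ht.2]⟩]

theorem hasLeftLim_selector (H : ExpandingLift T g h K k) (γ : ℝ) :
    HasLeftLim (selector h γ) γ (h (γ + 1)) := by
  have h1 : Tendsto (fun t : ℝ => (h (γ + t + 1) : Circ)) (𝓝[<] (0 : ℝ))
      (𝓝 (h (γ + 0 + 1) : Circ)) :=
    ((circ_continuous_coe.comp (H.continuous_h.comp (by fun_prop))).tendsto 0).mono_left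
      nhdsWithin_le_nhds
  rw [add_zero] at h1
  refine h1.congr' ?_
  filter_upwards [Ioo_mem_nhdsLT (show (-1 : ℝ) < 0 by norm_num)] with t ht
  rw [← AddCircle.coe_add, ← circ_coe_add_one (γ + t),
    selector_coe h ⟨by linarith [ht.1], by linarith [ht.2]⟩]

/-- Contraction makes the arc shorter than a full turn, so the jump of the selector is genuine. -/
theorem coe_h_ne (H : ExpandingLift T g h K k) (γ : ℝ) :
    (h (γ + 1) : Circ) ≠ (h γ : Circ) := by
  intro heq
  obtain ⟨n, hn⟩ := circ_coe_eq_coe_iff.1 heq.symm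
  have h1 := H.h_one_sub_lt γ
  have h2 := H.strictMono_h (show γ < γ + 1 by linarith)
  have h3 : (n : ℝ) < 1 := by linarith
  have h4 : (0 : ℝ) < n := by linarith
  have h3' : n < 1 := by exact_mod_cast h3
  have h4' : 0 < n := by exact_mod_cast h4
  omega

theorem discontinuities_selector (H : ExpandingLift T g h K k) (γ : ℝ) :
    discontinuities (selector h γ) = {(γ : Circ)} := by
  ext x
  rw [Set.mem_singleton_iff]
  constructor
  · intro hx
    by_contra hne
    refine hx ?_
    exact (circ_continuous_coe.comp H.continuous_h).continuousAt.comp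
      (continuousAt_subtype_val.comp (AddCircle.continuousAt_equivIco 1 γ hne))
  · rintro rfl hcont
    have h0 : Tendsto (fun t : ℝ => selector h γ ((γ : Circ) + (t : Circ))) (𝓝 0)
        (𝓝 (selector h γ (γ : Circ))) := by
      have : Tendsto (fun t : ℝ => (γ : Circ) + (t : Circ)) (𝓝 0) (𝓝 (γ : Circ)) := by
        have h1 : Continuous fun t : ℝ => (γ : Circ) + (t : Circ) :=
          continuous_const.add circ_continuous_coe
        have h2 := h1.tendsto 0
        rwa [AddCircle.coe_zero, add_zero] at h2
      exact hcont.tendsto.comp this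
    refine H.coe_h_ne γ ?_
    rw [← tendsto_nhds_unique (h0.mono_left nhdsWithin_le_nhds) (H.hasLeftLim_selector γ),
      ← tendsto_nhds_unique (h0.mono_left nhdsWithin_le_nhds) (H.hasRightLim_selector γ)]

theorem isFlower_arc (H : ExpandingLift T g h K k) (γ : ℝ) :
    IsFlower T 1 ((fun x : ℝ => (x : Circ)) '' Set.Icc (h γ) (h (γ + 1))) := by
  refine ⟨le_rfl, selector h γ, ⟨H.T_selector γ, ?_, ?_⟩, ?_, ?_⟩
  · rw [H.discontinuities_selector]
    exact Set.finite_singleton _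
  · rw [H.discontinuities_selector]
    rintro x rfl
    refine ⟨h (γ + 1), h γ, H.hasLeftLim_selector γ, H.hasRightLim_selector γ, H.coe_h_ne γ,
      Or.inr (selector_coe h ⟨le_rfl, by linarith⟩)⟩
  · rw [H.discontinuities_selector, Set.ncard_singleton]
  · have hlt : h γ < h (γ + 1) := H.strictMono_h (by linarith)
    apply Set.Subset.antisymm
    · rw [← closure_Ico hlt.ne]
      refine (image_closure_subset_closure_image circ_continuous_coe).trans (closure_mono ?_)
      rintro _ ⟨y, hy, rfl⟩
      refine ⟨(g y : Circ), ?_⟩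
      rw [selector_coe, H.h_g]
      refine ⟨?_, ?_⟩
      · rw [← H.strictMono_h.le_iff_le, H.h_g]; exact hy.1
      · rw [← H.strictMono_h.lt_iff_lt, H.h_g]; exact hy.2
    · refine closure_minimal ?_ (isCompact_arc _ _).isClosed
      rintro _ ⟨x, rfl⟩
      refine ⟨_, ?_, rfl⟩
      have := (AddCircle.equivIco 1 γ x).2
      exact ⟨H.strictMono_h.monotone this.1, H.strictMono_h.monotone this.2.le⟩

end ExpandingLift

/-! ### Quasi-periodic solutions of the flattening equation -/

/-- The function which agrees with `v` on `[γ, γ + 1]` and has constant increments over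
translations by one. -/
noncomputable def quasiExt (γ : ℝ) (v : ℝ → ℝ) (x : ℝ) : ℝ :=
  v (x - ⌊x - γ⌋) + ⌊x - γ⌋ * (v (γ + 1) - v γ)

theorem quasiExt_add_one (γ : ℝ) (v : ℝ → ℝ) (x : ℝ) :
    quasiExt γ v (x + 1) = quasiExt γ v x + (v (γ + 1) - v γ) := by
  have e : ⌊x + 1 - γ⌋ = ⌊x - γ⌋ + 1 := by
    rw [← Int.floor_add_one]
    congr 1
    ring
  simp only [quasiExt, e]
  push_cast
  rw [show x + 1 - ((⌊x - γ⌋ : ℝ) + 1) = x - ⌊x - γ⌋ by ring]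
  ring

theorem quasiExt_of_mem {γ x : ℝ} (v : ℝ → ℝ) (hx : x ∈ Set.Ico γ (γ + 1)) :
    quasiExt γ v x = v x := by
  have e : ⌊x - γ⌋ = 0 := by
    rw [Int.floor_eq_zero_iff]
    exact ⟨by linarith [hx.1], by linarith [hx.2]⟩
  simp [quasiExt, e]

theorem quasiExt_sub (γ : ℝ) (v w : ℝ → ℝ) (x : ℝ) :
    quasiExt γ v x - quasiExt γ w x = quasiExt γ (fun z => v z - w z) x := by
  simp only [quasiExt]
  ring

theorem abs_quasiExt_sub_le {γ M : ℝ} {v : ℝ → ℝ} (hv : ∀ x y, |v x - v y| ≤ M * |x - y|)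
    (x y : ℝ) : |quasiExt γ v x - quasiExt γ v y| ≤ M * |x - y| := by
  wlog hxy : y ≤ x generalizing x y
  · rw [abs_sub_comm, abs_sub_comm x]
    exact this y x (le_of_not_ge hxy)
  rw [abs_of_nonneg (sub_nonneg.2 hxy)]
  have hm : ⌊y - γ⌋ ≤ ⌊x - γ⌋ := Int.floor_mono (by linarith)
  have hx1 := Int.floor_le (x - γ)
  have hy2 := Int.lt_floor_add_one (y - γ)
  simp only [quasiExt]
  set n := ⌊x - γ⌋
  set m := ⌊y - γ⌋
  rcases hm.eq_or_lt with heq | hlt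
  · rw [heq]
    have := hv (x - n) (y - n)
    rw [sub_sub_sub_cancel_right, abs_of_nonneg (sub_nonneg.2 hxy)] at this
    convert this using 2
    ring
  -- The increment splits into a tail in the cell of `y`, `n - m - 1` full periods, and a head in
  -- the cell of `x`. The three lengths add up to `x - y`, so the constant `M` is not lost.
  · have hnm : (m : ℝ) + 1 ≤ n := by exact_mod_cast hlt
    have h1 := hv (x - n) γ
    have h2 := hv (γ + 1) (y - m)
    have h3 := hv (γ + 1) γ
    rw [abs_of_nonneg (show 0 ≤ x - n - γ by linarith)] at h1
    rw [abs_of_nonneg (show 0 ≤ γ + 1 - (y - m) by linarith)] at h2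
    rw [add_sub_cancel_left, abs_one, mul_one] at h3
    have h4 : |((n : ℝ) - m - 1) * (v (γ + 1) - v γ)| ≤ (n - m - 1) * M := by
      rw [abs_mul, abs_of_nonneg (show (0 : ℝ) ≤ n - m - 1 by linarith)]
      exact mul_le_mul_of_nonneg_left h3 (by linarith)
    have h5 := abs_add_three (v (x - n) - v γ) (v (γ + 1) - v (y - m))
      (((n : ℝ) - m - 1) * (v (γ + 1) - v γ))
    calc _ = |v (x - n) - v γ + (v (γ + 1) - v (y - m)) +
          ((n : ℝ) - m - 1) * (v (γ + 1) - v γ)| := by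
          congr 1; ring
      _ ≤ _ := h5
      _ ≤ M * (x - n - γ) + M * (γ + 1 - (y - m)) + (n - m - 1) * M :=
          add_le_add (add_le_add h1 h2) h4
      _ = _ := by ring

/-- `φ` is `L`-Lipschitz, has constant increments over translations by one, and satisfies the
flattening equation of `F` along the branch `h` on `(γ, γ + 1)`. -/
structure IsQuasiSolution (h F : ℝ → ℝ) (L γ : ℝ) (φ : ℝ → ℝ) : Prop where
  add_one : ∀ x, φ (x + 1) = φ x + φ 1
  abs_sub_le : ∀ x y, |φ x - φ y| ≤ L * |x - y|
  sub_eq : ∀ x y, x ∈ Set.Ioo γ (γ + 1) → y ∈ Set.Ioo γ (γ + 1) →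
    φ y - φ x = F (h y) - F (h x) + (φ (h y) - φ (h x))

/-- The operator whose fixed points are the quasi-periodic solutions. -/
noncomputable def quasiOp (h F : ℝ → ℝ) (γ : ℝ) (u : ℝ → ℝ) (x : ℝ) : ℝ :=
  quasiExt γ (fun z => F (h z) + u (h z)) x - quasiExt γ (fun z => F (h z) + u (h z)) 0

section quasiOp

variable {h F : ℝ → ℝ} {γ K A : ℝ}

theorem quasiOp_add_one (u : ℝ → ℝ) (x : ℝ) :
    quasiOp h F γ u (x + 1) = quasiOp h F γ u x + quasiOp h F γ u 1 := by
  have h1 := quasiExt_add_one γ (fun z => F (h z) + u (h z)) x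
  have h2 := quasiExt_add_one γ (fun z => F (h z) + u (h z)) 0
  rw [zero_add] at h2
  simp only [quasiOp, h1, h2]
  ring

theorem abs_quasiOp_sub_le (hh : ∀ x y, |h x - h y| ≤ |x - y| / K) (hA : 0 ≤ A)
    (hF : ∀ x y, |F x - F y| ≤ A * |x - y|) {u : ℝ → ℝ} {M : ℝ} (hM : 0 ≤ M)
    (hu : ∀ x y, |u x - u y| ≤ M * |x - y|) (x y : ℝ) :
    |quasiOp h F γ u x - quasiOp h F γ u y| ≤ (A + M) / K * |x - y| := by
  rw [quasiOp, quasiOp, sub_sub_sub_cancel_right]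
  refine abs_quasiExt_sub_le (fun x y => ?_) x y
  calc |F (h x) + u (h x) - (F (h y) + u (h y))| = |(F (h x) - F (h y)) + (u (h x) - u (h y))| := by
        congr 1; ring
    _ ≤ A * |h x - h y| + M * |h x - h y| := (abs_add_le _ _).trans (add_le_add (hF _ _) (hu _ _))
    _ = (A + M) * |h x - h y| := by ring
    _ ≤ (A + M) * (|x - y| / K) := mul_le_mul_of_nonneg_left (hh x y) (by linarith)
    _ = _ := by ring

theorem abs_quasiOp_sub_quasiOp_le (hh : ∀ x y, |h x - h y| ≤ |x - y| / K)
    {u w : ℝ → ℝ} {M : ℝ} (hM : 0 ≤ M)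
    (hu : ∀ x y, |u x - w x - (u y - w y)| ≤ M * |x - y|) (x y : ℝ) :
    |quasiOp h F γ u x - quasiOp h F γ w x - (quasiOp h F γ u y - quasiOp h F γ w y)| ≤
      M / K * |x - y| := by
  have e : quasiOp h F γ u x - quasiOp h F γ w x - (quasiOp h F γ u y - quasiOp h F γ w y) =
      quasiExt γ (fun z => u (h z) - w (h z)) x - quasiExt γ (fun z => u (h z) - w (h z)) y := by
    have e1 : (fun z => u (h z) - w (h z)) =
        fun z => (F (h z) + u (h z)) - (F (h z) + w (h z)) := by
      ext z; ring
    rw [e1, ← quasiExt_sub, ← quasiExt_sub]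
    simp only [quasiOp]
    ring
  rw [e]
  refine abs_quasiExt_sub_le (fun x y => (hu _ _).trans ?_) x y
  calc M * |h x - h y| ≤ M * (|x - y| / K) := mul_le_mul_of_nonneg_left (hh x y) hM
    _ = _ := by ring

/-- Picard iteration from zero. The constant `A / (K - 1)` is the fixed point of `M ↦ (A + M) / K`,
so all iterates share it. Differences of successive iterates have Lipschitz constants decaying like
`(1 / K) ^ n`, and the normalisation at `0` turns this into pointwise convergence. -/
theorem exists_isQuasiSolution (hK : 1 < K) (hh : ∀ x y, |h x - h y| ≤ |x - y| / K) (hA : 0 ≤ A)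
    (hF : ∀ x y, |F x - F y| ≤ A * |x - y|) (γ : ℝ) :
    ∃ φ, IsQuasiSolution h F (A / (K - 1)) γ φ := by
  have hK0 : 0 < K := zero_lt_one.trans hK
  have hK1 : 0 < K - 1 := sub_pos.2 hK
  set u : ℕ → ℝ → ℝ := fun n => (quasiOp h F γ)^[n] (fun _ => 0) with hu
  have hsucc : ∀ n, u (n + 1) = quasiOp h F γ (u n) := fun n => by
    simp only [hu, Function.iterate_succ_apply']
  have hlip : ∀ n x y, |u n x - u n y| ≤ A / (K - 1) * |x - y| := by
    intro n
    induction n with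
    | zero => intro x y; simp only [hu, Function.iterate_zero, id, sub_self, abs_zero]; positivity
    | succ n ih =>
      intro x y
      rw [hsucc]
      refine (abs_quasiOp_sub_le hh hA hF (by positivity) ih x y).trans_eq ?_
      congr 1
      field_simp
      ring
  have hzero : ∀ n, u n 0 = 0 := by
    intro n
    cases n with
    | zero => rfl
    | succ n => rw [hsucc]; simp [quasiOp]
  have hdiff : ∀ n x y, |u (n + 1) x - u n x - (u (n + 1) y - u n y)| ≤
      A / (K - 1) * (1 / K) ^ n * |x - y| := by
    intro n
    induction n with
    | zero =>
      intro x y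
      have := hlip 1 x y
      simpa [hu] using this
    | succ n ih =>
      intro x y
      rw [hsucc (n + 1)]
      nth_rewrite 2 4 [hsucc n]
      refine (abs_quasiOp_sub_quasiOp_le hh (by positivity) ih x y).trans_eq ?_
      rw [pow_succ]
      ring
  have hcauchy : ∀ x, CauchySeq fun n => u n x := by
    intro x
    refine cauchySeq_of_le_geometric (1 / K) (A / (K - 1) * |x|) (by rwa [div_lt_one hK0]) ?_
    intro n
    have := hdiff n x 0
    rw [hzero, hzero, sub_zero, sub_zero, sub_zero] at this
    rw [dist_comm, Real.dist_eq]
    linarith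
  choose φ hφ using fun x => cauchySeq_tendsto_of_complete (hcauchy x)
  have hφ' : ∀ x, Tendsto (fun n => u (n + 1) x) atTop (𝓝 (φ x)) := fun x =>
    (hφ x).comp (tendsto_add_atTop_nat 1)
  refine ⟨φ, fun x => ?_, fun x y => ?_, fun x y hx hy => ?_⟩
  · refine tendsto_nhds_unique (hφ' (x + 1)) (((hφ' x).add (hφ' 1)).congr fun n => ?_)
    rw [hsucc, ← quasiOp_add_one]
  · exact le_of_tendsto ((hφ x).sub (hφ y)).abs (Eventually.of_forall fun n => hlip n x y)
  · refine tendsto_nhds_unique ((hφ' y).sub (hφ' x))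
      ((tendsto_const_nhds.add ((hφ (h y)).sub (hφ (h x)))).congr fun n => ?_)
    rw [hsucc, quasiOp, quasiOp, quasiExt_of_mem _ (Set.Ioo_subset_Ico_self hx),
      quasiExt_of_mem _ (Set.Ioo_subset_Ico_self hy)]
    ring

end quasiOp

namespace IsQuasiSolution

variable {h F : ℝ → ℝ} {L γ : ℝ} {φ : ℝ → ℝ}

theorem continuous (H : IsQuasiSolution h F L γ φ) : Continuous φ := by
  have : LipschitzWith (Real.toNNReal L) φ := LipschitzWith.of_dist_le' fun x y => by
    rw [Real.dist_eq, Real.dist_eq]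
    exact H.abs_sub_le x y
  exact this.continuous

theorem sub_eq_of_mem_Icc (H : IsQuasiSolution h F L γ φ) (hF : Continuous F) (hh : Continuous h)
    {x y : ℝ} (hx : x ∈ Set.Icc γ (γ + 1)) (hy : y ∈ Set.Icc γ (γ + 1)) :
    φ y - φ x = F (h y) - F (h x) + (φ (h y) - φ (h x)) := by
  have hc := H.continuous
  set D : ℝ → ℝ := fun x => φ x - F (h x) - φ (h x) with hD
  have hDc : Continuous D := by fun_prop
  have hm : γ + 1 / 2 ∈ Set.Ioo γ (γ + 1) := by constructor <;> linarith
  have key : Set.EqOn D (fun _ => D (γ + 1 / 2)) (closure (Set.Ioo γ (γ + 1))) := by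
    refine Set.EqOn.closure (fun z hz => ?_) hDc continuous_const
    have := H.sub_eq z (γ + 1 / 2) hz hm
    simp only [hD]
    linarith
  rw [closure_Ioo (by linarith)] at key
  have h1 := key hx
  have h2 := key hy
  simp only [hD] at h1 h2
  linarith

theorem add_int (H : IsQuasiSolution h F L γ φ) (x : ℝ) (n : ℤ) : φ (x + n) = φ x + n * φ 1 := by
  induction n with
  | zero => simp
  | succ n ih =>
    push_cast at ih ⊢
    rw [← add_assoc, H.add_one, ih]
    ring
  | pred n ih =>
    have := H.add_one (x + (-n - 1))
    push_cast at ih ⊢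
    rw [show x + (-(n : ℝ) - 1) + 1 = x + -n by ring, ih] at this
    linarith

/-- If the increments of `F` to the right of `P` are nonpositive and `P` is stable under the
right-continuous branch, then the increments of a solution to the right of `P` are nonpositive. -/
theorem one_nonpos (H : IsQuasiSolution h F L γ φ) (hF : Continuous F) (hh : Continuous h)
    {K : ℝ} (hK : 1 < K) (hL : 0 ≤ L) (hmono : Monotone h)
    (hcontr : ∀ x y, |h x - h y| ≤ |x - y| / K)
    (hF0 : ∀ x, F x ≤ 0) {P : Set ℝ} (hFP : ∀ x ∈ P, F x = 0)
    (hP : ∀ x ∈ P, ∀ n : ℤ, x + n ∈ P) (hγ : γ ∈ P)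
    (hPh : ∀ x ∈ P, γ ≤ x → x < γ + 1 → h x ∈ P) : φ 1 ≤ 0 := by
  have hK0 : 0 < K := zero_lt_one.trans hK
  -- Each pass through the flattening equation gains a factor `1 / K`, and the `F`-terms can only
  -- help because `F` vanishes at the base point and is nonpositive at the other.
  have key : ∀ n : ℕ, ∀ x ∈ P, ∀ y, x ≤ y → y ≤ x + 1 →
      φ y - φ x ≤ L * (1 / K) ^ n * (y - x) := by
    intro n
    induction n with
    | zero =>
      intro x _ y hxy _
      rw [pow_zero, mul_one, ← abs_of_nonneg (sub_nonneg.2 hxy)]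
      exact (le_abs_self _).trans (H.abs_sub_le y x)
    | succ n ih =>
      have hshort : ∀ x ∈ P, γ ≤ x → x < γ + 1 → ∀ y, x ≤ y → y ≤ γ + 1 →
          φ y - φ x ≤ L * (1 / K) ^ (n + 1) * (y - x) := by
        intro x hx hx1 hx2 y hxy hy
        rw [H.sub_eq_of_mem_Icc hF hh ⟨hx1, hx2.le⟩ ⟨hx1.trans hxy, hy⟩,
          hFP _ (hPh x hx hx1 hx2)]
        have h1 := hcontr y x
        rw [abs_of_nonneg (sub_nonneg.2 (hmono hxy)), abs_of_nonneg (sub_nonneg.2 hxy)] at h1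
        have h2 : (y - x) / K ≤ 1 := by
          rw [div_le_one hK0]
          linarith
        have h3 := ih (h x) (hPh x hx hx1 hx2) (h y) (hmono hxy) (by linarith)
        have h4 : L * (1 / K) ^ n * (h y - h x) ≤ L * (1 / K) ^ n * ((y - x) / K) :=
          mul_le_mul_of_nonneg_left h1 (by positivity)
        have h5 : L * (1 / K) ^ (n + 1) * (y - x) = L * (1 / K) ^ n * ((y - x) / K) := by
          rw [pow_succ]
          ring
        linarith [hF0 (h y)]
      intro x hx y hxy hy
      obtain ⟨j, hj1, hj2⟩ := circ_exists_mem_Ico γ x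
      have e1 := H.add_int x j
      have e2 := H.add_int y j
      rcases le_total (y + j) (γ + 1) with hle | hle
      · have := hshort _ (hP x hx j) hj1 hj2 (y + j) (by linarith) hle
        rw [add_sub_add_right_eq_sub] at this
        linarith
      -- An interval crossing the cut is split at `γ + 1`, and the second piece is translated to
      -- start at `γ`. This is a legitimate base point because `γ ∈ P`.
      · have h1 := hshort _ (hP x hx j) hj1 hj2 (γ + 1) hj2.le le_rfl
        have h2 := hshort γ hγ le_rfl (by linarith) (y + j - 1) (by linarith) (by linarith)
        have e3 := H.add_one γ
        have e4 := H.add_one (y + j - 1)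
        rw [sub_add_cancel] at e4
        have e5 : L * (1 / K) ^ (n + 1) * (y - x) =
            L * (1 / K) ^ (n + 1) * (γ + 1 - (x + j)) +
            L * (1 / K) ^ (n + 1) * (y + j - 1 - γ) := by ring
        linarith
  have h1 : ∀ n : ℕ, φ 1 ≤ L * (1 / K) ^ n := fun n => by
    have := key n γ hγ (γ + 1) (by linarith) le_rfl
    rw [H.add_one] at this
    linarith
  have h2 : Tendsto (fun n : ℕ => L * (1 / K) ^ n) atTop (𝓝 (L * 0)) :=
    (tendsto_pow_atTop_nhds_zero_of_lt_one (by positivity) (by rwa [div_lt_one hK0])).const_mul L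
  rw [mul_zero] at h2
  exact ge_of_tendsto' h2 h1

/-- Conjugation by `x ↦ -x` exchanges left and right and reverses the sign of the quasi-period, so
the two sign estimates need only one proof. -/
theorem reflect (H : IsQuasiSolution h F L γ φ) :
    IsQuasiSolution (fun x => -h (-x)) (fun x => F (-x)) L (-(γ + 1)) (fun x => φ (-x)) := by
  have hm : φ (-1) = - φ 1 := by
    have h1 := H.add_one (-1)
    have h0 := H.add_one 0
    norm_num at h1 h0
    linarith
  refine ⟨fun x => ?_, fun x y => ?_, fun x y hx hy => ?_⟩
  · have := H.add_one (-(x + 1))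
    rw [show -(x + 1) + 1 = -x by ring] at this
    linarith
  · refine (H.abs_sub_le _ _).trans_eq ?_
    rw [neg_sub_neg, abs_sub_comm]
  · have := H.sub_eq (-x) (-y) ⟨by linarith [hx.2], by linarith [hx.1]⟩
      ⟨by linarith [hy.2], by linarith [hy.1]⟩
    simpa only [neg_neg] using this

theorem one_nonneg (H : IsQuasiSolution h F L γ φ) (hF : Continuous F) (hh : Continuous h)
    {K : ℝ} (hK : 1 < K) (hL : 0 ≤ L) (hmono : Monotone h)
    (hcontr : ∀ x y, |h x - h y| ≤ |x - y| / K)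
    (hF0 : ∀ x, F x ≤ 0) {P : Set ℝ} (hFP : ∀ x ∈ P, F x = 0)
    (hP : ∀ x ∈ P, ∀ n : ℤ, x + n ∈ P) (hγ : γ + 1 ∈ P)
    (hPh : ∀ x ∈ P, γ < x → x ≤ γ + 1 → h x ∈ P) : 0 ≤ φ 1 := by
  have h1 := H.reflect.one_nonpos (P := {x | -x ∈ P}) (by fun_prop) (by fun_prop) hK hL
    (fun x y hxy => neg_le_neg (hmono (neg_le_neg hxy)))
    (fun x y => by
      have := hcontr (-y) (-x)
      rwa [neg_sub_neg] at this ⊢) (fun x => hF0 _) (fun x hx => hFP _ hx)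
    (fun x hx n => by
      have := hP _ hx (-n)
      rw [Set.mem_ofPred_eq]
      convert this using 1
      push_cast
      ring) (by simpa using hγ)
    (fun x hx h1 h2 => by
      have := hPh _ hx (by linarith) (by linarith)
      simpa using this)
  have h2 := H.add_one (-1)
  have h0 := H.add_one 0
  norm_num at h2 h0
  linarith

theorem convex_combination (H : IsQuasiSolution h F L γ φ) {ψ : ℝ → ℝ}
    (H' : IsQuasiSolution h F L γ ψ) {s t : ℝ} (hs : 0 ≤ s) (ht : 0 ≤ t) (hst : s + t = 1) :
    IsQuasiSolution h F L γ (fun x => s * φ x + t * ψ x) := by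
  refine ⟨fun x => ?_, fun x y => ?_, fun x y hx hy => ?_⟩
  · simp only [H.add_one x, H'.add_one x]
    ring
  · calc |s * φ x + t * ψ x - (s * φ y + t * ψ y)| = |s * (φ x - φ y) + t * (ψ x - ψ y)| := by
          congr 1; ring
      _ ≤ |s * (φ x - φ y)| + |t * (ψ x - ψ y)| := abs_add_le _ _
      _ = s * |φ x - φ y| + t * |ψ x - ψ y| := by
          rw [abs_mul, abs_mul, abs_of_nonneg hs, abs_of_nonneg ht]
      _ ≤ s * (L * |x - y|) + t * (L * |x - y|) :=
          add_le_add (mul_le_mul_of_nonneg_left (H.abs_sub_le x y) hs)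
            (mul_le_mul_of_nonneg_left (H'.abs_sub_le x y) ht)
      _ = (s + t) * (L * |x - y|) := by ring
      _ = _ := by rw [hst, one_mul]
  · have h1 := H.sub_eq x y hx hy
    have h2 := H'.sub_eq x y hx hy
    calc _ = s * (φ y - φ x) + t * (ψ y - ψ x) := by ring
      _ = (s + t) * (F (h y) - F (h x)) + s * (φ (h y) - φ (h x)) + t * (ψ (h y) - ψ (h x)) := by
        rw [h1, h2]; ring
      _ = _ := by rw [hst]; ring

end IsQuasiSolution

/-! ### Dependence of the quasi-periodic solutions on the cut point -/

theorem isClosed_setOf_isQuasiSolution (h F : ℝ → ℝ) (L : ℝ) :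
    IsClosed {p : ℝ × (ℝ → ℝ) | IsQuasiSolution h F L p.1 p.2} := by
  have e : {p : ℝ × (ℝ → ℝ) | IsQuasiSolution h F L p.1 p.2} =
      {p | ∀ x, p.2 (x + 1) = p.2 x + p.2 1} ∩ {p | ∀ x y, |p.2 x - p.2 y| ≤ L * |x - y|} ∩
      {p | ∀ x y, x ∈ Set.Ioo p.1 (p.1 + 1) → y ∈ Set.Ioo p.1 (p.1 + 1) →
        p.2 y - p.2 x = F (h y) - F (h x) + (p.2 (h y) - p.2 (h x))} := by
    ext p
    exact ⟨fun H => ⟨⟨H.1, H.2⟩, H.3⟩, fun H => ⟨H.1.1, H.1.2, H.2⟩⟩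
  have hev : ∀ x : ℝ, Continuous fun p : ℝ × (ℝ → ℝ) => p.2 x := fun x =>
    (continuous_apply x).comp continuous_snd
  -- The flattening equation is imposed on the open interval so that its premises are open in `γ`
  -- and the implication is a closed condition.
  have hopen : ∀ x : ℝ, IsOpen {p : ℝ × (ℝ → ℝ) | x ∈ Set.Ioo p.1 (p.1 + 1)} := fun x =>
    (isOpen_lt continuous_fst continuous_const).inter
      (isOpen_lt continuous_const (continuous_fst.add continuous_const))
  rw [e]
  refine (IsClosed.inter ?_ ?_).inter ?_
  · simp only [Set.ofPred_forall]
    exact isClosed_iInter fun x => isClosed_eq (hev _) ((hev _).add (hev _))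
  · simp only [Set.ofPred_forall]
    exact isClosed_iInter fun x => isClosed_iInter fun y =>
      isClosed_le ((hev _).sub (hev _)).abs continuous_const
  · rw [Set.ofPred_forall]
    refine isClosed_iInter fun x => ?_
    rw [Set.ofPred_forall]
    exact isClosed_iInter fun y => isClosed_imp (hopen x) (isClosed_imp (hopen y)
      (isClosed_eq ((hev _).sub (hev _)) (continuous_const.add ((hev _).sub (hev _)))))

/-- Quasi-periodicity forces `φ 0 = 0`, so the Lipschitz bound puts all solutions in a product of
compact intervals. By Tychonoff the set is the projection of a compact set. -/
theorem isClosed_setOf_exists_isQuasiSolution (h F : ℝ → ℝ) (L a b : ℝ) {S : Set ℝ}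
    (hS : IsClosed S) :
    IsClosed {γ | γ ∈ Set.Icc a b ∧ ∃ φ, IsQuasiSolution h F L γ φ ∧ φ 1 ∈ S} := by
  have hcomp : IsCompact (Set.Icc a b ×ˢ
      (Set.univ.pi fun x : ℝ => Set.Icc (-(L * |x|)) (L * |x|)) : Set (ℝ × (ℝ → ℝ))) :=
    isCompact_Icc.prod (isCompact_univ_pi fun x => isCompact_Icc)
  have hclosed : IsClosed ({p : ℝ × (ℝ → ℝ) | IsQuasiSolution h F L p.1 p.2} ∩
      {p | p.2 1 ∈ S}) :=
    (isClosed_setOf_isQuasiSolution h F L).inter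
      (hS.preimage ((continuous_apply 1).comp continuous_snd))
  have himage := ((hcomp.inter_right hclosed).image continuous_fst).isClosed
  convert himage using 1
  ext γ
  constructor
  · rintro ⟨hγ, φ, hφ, hφS⟩
    refine ⟨(γ, φ), ⟨⟨hγ, fun x _ => ?_⟩, hφ, hφS⟩, rfl⟩
    have h0 := hφ.add_one 0
    rw [zero_add] at h0
    have h1 := hφ.abs_sub_le x 0
    rw [show φ 0 = 0 by linarith, sub_zero, sub_zero] at h1
    exact abs_le.1 h1
  · rintro ⟨⟨γ', φ⟩, ⟨⟨hγ, -⟩, hφ, hφS⟩, rfl⟩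
    exact ⟨hγ, φ, hφ, hφS⟩

theorem exists_periodic_solution {h F : ℝ → ℝ} {L a b : ℝ} (hab : a ≤ b)
    (hex : ∀ γ, ∃ φ, IsQuasiSolution h F L γ φ)
    (ha : ∃ φ, IsQuasiSolution h F L a φ ∧ 0 ≤ φ 1)
    (hb : ∃ φ, IsQuasiSolution h F L b φ ∧ φ 1 ≤ 0) :
    ∃ γ ∈ Set.Icc a b, ∃ φ, IsQuasiSolution h F L γ φ ∧ φ 1 = 0 := by
  have hpre := isPreconnected_closed_iff.1 (isPreconnected_Icc (a := a) (b := b)) _ _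
    (isClosed_setOf_exists_isQuasiSolution h F L a b isClosed_Ici)
    (isClosed_setOf_exists_isQuasiSolution h F L a b isClosed_Iic) ?_
    ⟨a, ⟨le_rfl, hab⟩, ⟨le_rfl, hab⟩, ha⟩ ⟨b, ⟨hab, le_rfl⟩, ⟨hab, le_rfl⟩, hb⟩
  · obtain ⟨γ, hγ, ⟨-, φ, hφ, hφ1 : 0 ≤ φ 1⟩, ⟨-, ψ, hψ, hψ1 : ψ 1 ≤ 0⟩⟩ := hpre
    rcases hφ1.eq_or_lt with h0 | hpos
    · exact ⟨γ, hγ, φ, hφ, h0.symm⟩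
    · have hd : 0 < φ 1 - ψ 1 := by linarith
      -- The weights are those that cancel the two quasi-periods; uniqueness of solutions is never
      -- needed.
      refine ⟨γ, hγ, _, hφ.convex_combination hψ (s := -ψ 1 / (φ 1 - ψ 1))
        (t := φ 1 / (φ 1 - ψ 1)) (div_nonneg (by linarith) hd.le) (div_nonneg hφ1 hd.le) ?_, ?_⟩
      · field_simp
        ring
      · ring
  · intro γ hγ
    obtain ⟨φ, hφ⟩ := hex γ
    rcases le_total 0 (φ 1) with h0 | h0
    · exact Or.inl ⟨hγ, φ, hφ, h0⟩
    · exact Or.inr ⟨hγ, φ, hφ, h0⟩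

/-! ### Lipschitz sub-actions -/

/-- The sum of `F` along the first `n` points of the backward orbit of `x` under `h`. -/
def backwardSum (h F : ℝ → ℝ) : ℕ → ℝ → ℝ
  | 0, _ => 0
  | n + 1, x => F (h x) + backwardSum h F n (h x)

theorem backwardSum_eq_sum (h F : ℝ → ℝ) (n : ℕ) (x : ℝ) :
    backwardSum h F n x = ∑ i ∈ Finset.range n, F (h^[i + 1] x) := by
  induction n generalizing x with
  | zero => simp [backwardSum]
  | succ n ih =>
    rw [backwardSum, ih, Finset.sum_range_succ', add_comm]
    rfl

theorem abs_backwardSum_sub_le {h F : ℝ → ℝ} {K A : ℝ} (hK : 1 < K) (hA : 0 ≤ A)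
    (hh : ∀ x y, |h x - h y| ≤ |x - y| / K) (hF : ∀ x y, |F x - F y| ≤ A * |x - y|) (n : ℕ)
    (x y : ℝ) : |backwardSum h F n x - backwardSum h F n y| ≤ A / (K - 1) * |x - y| := by
  have hK1 : 0 < K - 1 := sub_pos.2 hK
  induction n generalizing x y with
  | zero => simp only [backwardSum, sub_self, abs_zero]; positivity
  | succ n ih =>
    calc |backwardSum h F (n + 1) x - backwardSum h F (n + 1) y|
        = |(F (h x) - F (h y)) + (backwardSum h F n (h x) - backwardSum h F n (h y))| := by
          simp only [backwardSum]
          congr 1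
          ring
      _ ≤ A * |h x - h y| + A / (K - 1) * |h x - h y| :=
          (abs_add_le _ _).trans (add_le_add (hF _ _) (ih _ _))
      _ = (A + A / (K - 1)) * |h x - h y| := by ring
      _ ≤ (A + A / (K - 1)) * (|x - y| / K) :=
          mul_le_mul_of_nonneg_left (hh x y) (by positivity)
      _ = _ := by
          have : K ≠ 0 := by linarith
          field_simp
          ring

/-- The weaker rate `1 / K` is kept because the closing lemma needs a bound uniform in `n`. -/
theorem abs_iterate_sub_le {h : ℝ → ℝ} {K : ℝ} (hK : 1 < K)
    (hh : ∀ x y, |h x - h y| ≤ |x - y| / K) (n : ℕ) (x y : ℝ) :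
    |h^[n + 1] x - h^[n + 1] y| ≤ |x - y| / K := by
  induction n with
  | zero => exact hh x y
  | succ n ih =>
    rw [Function.iterate_succ_apply', Function.iterate_succ_apply' h (n + 1)]
    refine (hh _ _).trans ?_
    exact div_le_div_of_nonneg_right (ih.trans (div_le_self (abs_nonneg _) hK.le)) (by linarith)

/-- The closing lemma: sums along backward orbits are bounded, if they are nonpositive along
periodic orbits. -/
theorem exists_backwardSum_le {h F : ℝ → ℝ} {K A : ℝ} (hK : 1 < K) (hA : 0 ≤ A)
    (hh : ∀ x y, |h x - h y| ≤ |x - y| / K) (hF : ∀ x y, |F x - F y| ≤ A * |x - y|)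
    (hper : ∀ (n : ℕ) (w : ℝ) (j : ℤ), h^[n + 1] w + j = w → backwardSum h F (n + 1) w ≤ 0) :
    ∃ C : ℝ, ∀ n x, backwardSum h F n x ≤ C := by
  have hK1 : 0 < K - 1 := sub_pos.2 hK
  have hK0 : 0 < K := by linarith
  refine ⟨A / (K - 1) * (K / (K - 1)), fun n x => ?_⟩
  cases n with
  | zero => simp only [backwardSum]; positivity
  | succ n =>
    have hc := abs_iterate_sub_le hK hh n
    obtain ⟨j, hj1, hj2⟩ := circ_exists_mem_Ico (h^[n + 1] x) x
    -- The integer `j` brings `x + j` within one of the end of its backward orbit, so `x` is moved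
    -- by at most one; the fixed point, which is periodic on the circle, is then within `K / (K -
    -- 1)` of `x`.
    have hlip : ContractingWith (Real.toNNReal K⁻¹) (fun z => h^[n + 1] z + ((-j : ℤ) : ℝ)) := by
      refine ⟨?_, LipschitzWith.of_dist_le' fun z w => ?_⟩
      · rw [Real.toNNReal_lt_one]
        exact inv_lt_one_of_one_lt₀ hK
      · rw [Real.dist_eq, Real.dist_eq, add_sub_add_right_eq_sub, inv_mul_eq_div]
        exact hc z w
    set w := hlip.fixedPoint with hw
    have hfix : h^[n + 1] w + ((-j : ℤ) : ℝ) = w := hlip.fixedPoint_isFixedPt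
    have h1 := hper n w (-j) hfix
    have h2 : |x - w| ≤ K / (K - 1) := by
      have h3 : |x - w| ≤ 1 + |x - w| / K := by
        calc |x - w| = |(x + j - h^[n + 1] x) + (h^[n + 1] x - h^[n + 1] w)| := by
              push_cast at hfix
              congr 1
              linarith
          _ ≤ 1 + |x - w| / K := by
              refine (abs_add_le _ _).trans (add_le_add ?_ (hc x w))
              rw [abs_of_nonneg (by linarith)]
              linarith
      rw [le_div_iff₀ hK1]
      have h4 : |x - w| / K * K = |x - w| := by field_simp
      nlinarith
    have h3 := (le_abs_self _).trans (abs_backwardSum_sub_le hK hA hh hF (n + 1) x w)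
    have h4 : A / (K - 1) * |x - w| ≤ A / (K - 1) * (K / (K - 1)) :=
      mul_le_mul_of_nonneg_left h2 (by positivity)
    linarith

/-- The sub-action is the supremum of sums over backward orbits. Translating the starting point by
integers reaches every branch and makes the supremum periodic; prefixing `y` to a backward orbit of
`y` gives one of `g y`, whence the inequality. -/
theorem ExpandingLift.exists_subaction {T : Circ → Circ} {g h : ℝ → ℝ} {K : ℝ} {k : ℤ}
    (H : ExpandingLift T g h K k) {F : ℝ → ℝ} {A : ℝ} (hA : 0 ≤ A)
    (hF : ∀ x y, |F x - F y| ≤ A * |x - y|) (hF1 : ∀ x, F (x + 1) = F x)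
    (hper : ∀ (n : ℕ) (w : ℝ) (j : ℤ), h^[n + 1] w + j = w → backwardSum h F (n + 1) w ≤ 0) :
    ∃ φ : ℝ → ℝ, (∀ x, φ (x + 1) = φ x) ∧
      (∀ x y, |φ x - φ y| ≤ A / (K - 1) * |x - y|) ∧ ∀ y, F y + φ y ≤ φ (g y) := by
  obtain ⟨C, hC⟩ := exists_backwardSum_le H.one_lt hA H.abs_h_sub_le hF hper
  have hbdd : ∀ x : ℝ, BddAbove (Set.range fun p : ℕ × ℤ => backwardSum h F p.1 (x + p.2)) := by
    rintro x
    refine ⟨C, ?_⟩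
    rintro _ ⟨p, rfl⟩
    exact hC _ _
  have hFint : ∀ (x : ℝ) (n : ℤ), F (x + n) = F x := by
    have : Function.Periodic F 1 := hF1
    intro x n
    simpa using this.int_mul n x
  refine ⟨fun x => ⨆ p : ℕ × ℤ, backwardSum h F p.1 (x + p.2), fun x => ?_, ?_, fun y => ?_⟩
  · refine le_antisymm (ciSup_le fun p => ?_) (ciSup_le fun p => ?_)
    · refine le_ciSup_of_le (hbdd x) (p.1, p.2 + 1) (le_of_eq ?_)
      push_cast
      congr 1
      ring
    · refine le_ciSup_of_le (hbdd (x + 1)) (p.1, p.2 - 1) (le_of_eq ?_)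
      push_cast
      congr 1
      ring
  · have key : ∀ x y : ℝ, (⨆ p : ℕ × ℤ, backwardSum h F p.1 (x + p.2)) ≤
        (⨆ p : ℕ × ℤ, backwardSum h F p.1 (y + p.2)) + A / (K - 1) * |x - y| := by
      intro x y
      refine ciSup_le fun p => ?_
      have h1 := (le_abs_self _).trans
        (abs_backwardSum_sub_le H.one_lt hA H.abs_h_sub_le hF p.1 (x + p.2) (y + p.2))
      rw [add_sub_add_right_eq_sub] at h1
      have h2 := le_ciSup (hbdd y) p
      linarith
    intro x y
    have h1 := key x y
    have h2 := key y x
    rw [abs_sub_comm] at h2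
    exact abs_le.2 ⟨by linarith, by linarith⟩
  · rw [← le_sub_iff_add_le']
    refine ciSup_le fun p => ?_
    rw [le_sub_iff_add_le']
    refine le_ciSup_of_le (hbdd (g y)) (p.1 + 1, p.2 * k) (le_of_eq ?_)
    push_cast
    rw [backwardSum, H.h_add_mul, H.h_g, hFint]

/-! ### Invariant measures -/

/-- The normalised sum of point masses along the cycle is an invariant competitor. The cycle is
indexed backwards to match iterates of `h`. -/
theorem integral_periodic_orbit_le {T : Circ → Circ} (hT : Continuous T) {f : Circ → ℝ}
    {α : ℝ} (hα : ∀ m ∈ invariantMeasures T, ∫ x, f x ∂m ≤ α) (n : ℕ)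
    (q : ℕ → Circ) (hq : ∀ i < n, T (q (i + 1)) = q i) (hq0 : T (q 0) = q n) :
    ∑ i ∈ Finset.range (n + 1), (f (q i) - α) ≤ 0 := by
  set ν : Measure Circ := ∑ i ∈ Finset.range (n + 1), Measure.dirac (q i) with hν
  have hn0 : ((n + 1 : ℕ) : ENNReal) ≠ 0 := by simp
  have hntop : ((n + 1 : ℕ) : ENNReal) ≠ ⊤ := ENNReal.natCast_ne_top _
  have hmap : Measure.map T ν = ν := by
    have h1 : Measure.map T ν = ∑ i ∈ Finset.range (n + 1), Measure.dirac (T (q i)) := by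
      ext s hs
      rw [Measure.map_apply hT.measurable hs, hν]
      simp only [Measure.coe_finsetSum, Finset.sum_apply]
      refine Finset.sum_congr rfl fun i _ => ?_
      rw [Measure.dirac_apply' _ (hT.measurable hs), Measure.dirac_apply' _ hs]
      rfl
    rw [h1, hν, Finset.sum_range_succ', Finset.sum_range_succ, hq0]
    congr 1
    exact Finset.sum_congr rfl fun i hi => by rw [hq i (Finset.mem_range.1 hi)]
  have hinv : ((n + 1 : ℕ) : ENNReal)⁻¹ • ν ∈ invariantMeasures T := by
    refine ⟨⟨?_⟩, hT.measurable, ?_⟩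
    · simp only [Measure.smul_apply, hν, Measure.coe_finsetSum, Finset.sum_apply,
        measure_univ, Finset.sum_const, Finset.card_range, smul_eq_mul, nsmul_eq_mul, mul_one]
      exact ENNReal.inv_mul_cancel hn0 hntop
    · rw [Measure.map_smul, hmap]
  have h1 := hα _ hinv
  rw [integral_smul_measure, hν, integral_finsetSum_measure] at h1
  · simp only [integral_dirac, smul_eq_mul, ENNReal.toReal_inv, ENNReal.toReal_natCast] at h1
    rw [Finset.sum_sub_distrib, Finset.sum_const, Finset.card_range, nsmul_eq_mul]
    rw [inv_mul_le_iff₀ (by positivity)] at h1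
    linarith
  · intro i _
    exact integrable_dirac (by simp)

theorem map_mem_support {T : Circ → Circ} (hT : Continuous T) {S : Measure Circ}
    (hS : MeasurePreserving T S S) {x : Circ} (hx : x ∈ S.support) : T x ∈ S.support := by
  rw [Measure.mem_support_iff_forall] at hx ⊢
  intro U hU
  obtain ⟨V, hVU, hV, hxV⟩ := mem_nhds_iff.1 hU
  have h1 := hx (T ⁻¹' V) ((hV.preimage hT).mem_nhds hxV)
  rw [hS.measure_preimage hV.measurableSet.nullMeasurableSet] at h1
  exact h1.trans_le (measure_mono hVU)

/-- The image of the support is compact and, by invariance, of full measure. -/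
theorem support_subset_image {T : Circ → Circ} (hT : Continuous T) {S : Measure Circ}
    (hS : MeasurePreserving T S S) : S.support ⊆ T '' S.support := by
  have hc : IsClosed (T '' S.support) := (Measure.isClosed_support.isCompact.image hT).isClosed
  refine Measure.support_subset_of_isClosed hc ?_
  have h1 : T ⁻¹' (T '' S.support) ∈ ae S :=
    mem_of_superset Measure.support_mem_ae (Set.subset_preimage_image _ _)
  have h2 := (mem_ae_map_iff hT.aemeasurable hc.measurableSet).2 h1
  rwa [hS.map_eq] at h2

theorem eq_zero_of_mem_support {ψ : Circ → ℝ} (hψ : Continuous ψ) {S : Measure Circ}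
    [IsFiniteMeasure S] (hψ0 : ∀ x, ψ x ≤ 0) (hint : ∫ x, ψ x ∂S = 0) {x : Circ}
    (hx : x ∈ S.support) : ψ x = 0 := by
  have hi : Integrable ψ S := hψ.integrable_of_hasCompactSupport (HasCompactSupport.of_compactSpace _)
  have h1 : -ψ =ᵐ[S] 0 := by
    rw [← integral_eq_zero_iff_of_nonneg (fun x => by simpa using hψ0 x) hi.neg, integral_neg',
      hint, neg_zero]
  have h2 : S.support ⊆ {x | ψ x = 0} := by
    refine Measure.support_subset_of_isClosed (isClosed_eq hψ continuous_const) ?_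
    filter_upwards [h1] with x hx
    simpa using hx
  exact h2 hx

theorem exists_circ_lift {φ : ℝ → ℝ} {L : ℝ} (h1 : ∀ x, φ (x + 1) = φ x)
    (hL : ∀ x y, |φ x - φ y| ≤ L * |x - y|) :
    ∃ Φ : Circ → ℝ, IsLip Φ ∧ ∀ x : ℝ, Φ (x : Circ) = φ x := by
  have hper : Function.Periodic φ 1 := h1
  refine ⟨hper.lift, ⟨Real.toNNReal L, LipschitzWith.of_dist_le' fun p q => ?_⟩, hper.lift_coe⟩
  obtain ⟨x, rfl⟩ := circ_exists_coe p
  obtain ⟨y, rfl, hy⟩ := circ_exists_lift_dist x q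
  rw [← hy, Real.dist_eq, hper.lift_coe, hper.lift_coe]
  exact hL x y

/-! ### Lipschitz flattening along a Sturmian maximizing measure -/

theorem IsLip.exists_dist_le {X Y : Type*} [PseudoMetricSpace X] [PseudoMetricSpace Y] {f : X → Y}
    (hf : IsLip f) : ∃ C : ℝ, 0 ≤ C ∧ ∀ x y, dist (f x) (f y) ≤ C * dist x y := by
  obtain ⟨C, hC⟩ := hf
  exact ⟨C, C.2, fun x y => hC.dist_le_mul x y⟩

theorem IsLip.continuous {X Y : Type*} [PseudoEMetricSpace X] [PseudoEMetricSpace Y] {f : X → Y}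
    (hf : IsLip f) : Continuous f := by
  obtain ⟨C, hC⟩ := hf
  exact hC.continuous

namespace ExpandingLift

variable {T : Circ → Circ} {g h : ℝ → ℝ} {K : ℝ} {k : ℤ}

/-- A Lipschitz function is Lipschitz cohomologous, up to an additive constant, to a nonpositive
function which vanishes on the supports of its maximizing measures. -/
theorem exists_normal_form (H : ExpandingLift T g h K k) (hT : Continuous T)
    {f : Circ → ℝ} (hf : IsLip f) {S : Measure Circ} (hS : IsMaximizing T f S) :
    ∃ (α A : ℝ) (Φ : Circ → ℝ), IsLip Φ ∧ 0 ≤ A ∧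
      (∀ x, f x - α + Φ x - Φ (T x) ≤ 0) ∧
      (∀ x ∈ S.support, f x - α + Φ x - Φ (T x) = 0) ∧
      ∀ x y : ℝ, |(f x - α + Φ x - Φ (T x)) - (f y - α + Φ y - Φ (T y))| ≤ A * |x - y| := by
  obtain ⟨⟨hprob, hinv⟩, hmax⟩ := hS
  obtain ⟨A₀, hA₀, hfA⟩ := hf.exists_dist_le
  set α := ∫ x, f x ∂S with hα
  have hF : ∀ x y : ℝ, |f x - α - (f y - α)| ≤ A₀ * |x - y| := fun x y => by
    rw [sub_sub_sub_cancel_right, ← Real.dist_eq]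
    exact (hfA _ _).trans (mul_le_mul_of_nonneg_left (circ_dist_coe_le x y) hA₀)
  obtain ⟨φ, hφ1, hφL, hφg⟩ := H.exists_subaction (F := fun x : ℝ => f x - α) hA₀ hF
    (fun x => by simp only [circ_coe_add_one]) (fun n w j hw => by
      rw [backwardSum_eq_sum]
      refine integral_periodic_orbit_le hT hmax n (fun i => (h^[i + 1] w : Circ)) ?_ ?_
      · intro i _
        simp only [Function.iterate_succ_apply' h (i + 1), H.T_coe_h]
      · simp only [zero_add, Function.iterate_one, H.T_coe_h]
        nth_rewrite 1 [← hw]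
        exact circ_coe_add_int _ _)
  obtain ⟨Φ, hΦ, hΦφ⟩ := exists_circ_lift hφ1 hφL
  obtain ⟨C, hC0, hC⟩ := H.exists_abs_g_le
  have hle : ∀ x, f x - α + Φ x - Φ (T x) ≤ 0 := by
    intro p
    obtain ⟨x, rfl⟩ := circ_exists_coe p
    rw [← H.coe_g, hΦφ, hΦφ]
    linarith [hφg x]
  have hK1 : 0 < K - 1 := sub_pos.2 H.one_lt
  set L := A₀ / (K - 1) with hL
  have hL0 : 0 ≤ L := by positivity
  have hci : ∀ ψ : Circ → ℝ, Continuous ψ → Integrable ψ S := fun ψ hψ =>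
    hψ.integrable_of_hasCompactSupport (HasCompactSupport.of_compactSpace _)
  have hfc := hf.continuous
  have hΦc := hΦ.continuous
  refine ⟨α, A₀ + L + L * C, Φ, hΦ, by positivity, hle, fun x hx => ?_, fun x y => ?_⟩
  · refine eq_zero_of_mem_support (ψ := fun x => f x - α + Φ x - Φ (T x)) (by fun_prop) hle ?_ hx
    have h1 : ∫ x, Φ (T x) ∂S = ∫ x, Φ x ∂S := by
      have := integral_map (μ := S) (φ := T) (f := Φ) hT.aemeasurable
        hΦc.aestronglyMeasurable
      rw [hinv.map_eq] at this
      exact this.symm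
    rw [integral_sub (hci _ (by fun_prop)) (hci _ (by fun_prop)),
      integral_add (hci _ (by fun_prop)) (hci _ (by fun_prop)),
      integral_sub (hci _ (by fun_prop)) (hci _ (by fun_prop)), h1, integral_const]
    simp [← hα]
  · rw [← H.coe_g, ← H.coe_g, hΦφ, hΦφ, hΦφ, hΦφ]
    calc _ = |(f x - α - (f y - α)) + (φ x - φ y) + (φ (g y) - φ (g x))| := by
          congr 1; ring
      _ ≤ A₀ * |x - y| + L * |x - y| + L * (C * |x - y|) := by
          refine (abs_add_three _ _ _).trans (add_le_add (add_le_add (hF x y) (hφL x y)) ?_)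
          rw [abs_sub_comm]
          exact (hφL _ _).trans (mul_le_mul_of_nonneg_left (hC x y) hL0)
      _ = _ := by ring

/-- The parameters of the arcs obtained by sliding an arc containing `X` until one of its
end points meets `X`. -/
theorem exists_arc_range (H : ExpandingLift T g h K k) {X : Set Circ} (hX : IsClosed X)
    (hne : X.Nonempty) {γ₀ : ℝ}
    (hXγ : X ⊆ (fun x : ℝ => (x : Circ)) '' Set.Icc (h γ₀) (h (γ₀ + 1))) :
    ∃ γ₁ γ₂ : ℝ, γ₁ ≤ γ₂ ∧ (h (γ₁ + 1) : Circ) ∈ X ∧ (h γ₂ : Circ) ∈ X ∧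
      ∀ γ ∈ Set.Icc γ₁ γ₂, X ⊆ (fun x : ℝ => (x : Circ)) '' Set.Icc (h γ) (h (γ + 1)) := by
  set P : Set ℝ := {x | (x : Circ) ∈ X} with hPdef
  have hP : ∀ x ∈ P, ∀ n : ℤ, x + n ∈ P := fun x hx n => by
    change ((x + n : ℝ) : Circ) ∈ X
    rw [circ_coe_add_int]
    exact hx
  have hPc : IsClosed P := hX.preimage circ_continuous_coe
  obtain ⟨p, hp⟩ := hne
  obtain ⟨x₀, rfl⟩ := circ_exists_coe p
  obtain ⟨m, hm, -⟩ := circ_exists_mem_Ico (h γ₀) x₀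
  obtain ⟨n, -, hn⟩ := circ_exists_mem_Ico (h (γ₀ + 1) - 2) x₀
  -- The complementary gap `(h (γ₀ + 1) - 1, h γ₀)` misses `P`. Let `l` and `r` be the points of `P`
  -- nearest to it on either side: an arc keeps `X` as long as its own gap stays inside `(l, r)`.
  have hr := (hPc.inter isClosed_Ici).isLeast_csInf (s := P ∩ Set.Ici (h γ₀))
    ⟨x₀ + m, hP _ hp m, hm⟩ ⟨h γ₀, fun y hy => hy.2⟩
  have hl := (hPc.inter isClosed_Iic).isGreatest_csSup (s := P ∩ Set.Iic (h (γ₀ + 1) - 1))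
    ⟨x₀ + n, hP _ hp n, by change x₀ + n ≤ h (γ₀ + 1) - 1; linarith⟩
    ⟨h (γ₀ + 1) - 1, fun y hy => hy.2⟩
  set r := sInf (P ∩ Set.Ici (h γ₀))
  set l := sSup (P ∩ Set.Iic (h (γ₀ + 1) - 1))
  obtain ⟨⟨hrP, hr1 : h γ₀ ≤ r⟩, hr2⟩ := hr
  obtain ⟨⟨hlP, hl1 : l ≤ h (γ₀ + 1) - 1⟩, hl2⟩ := hl
  have hgap : ∀ z ∈ P, l < z → z < r → False := by
    intro z hz hlz hzr
    have h1 : z < h γ₀ := by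
      by_contra! hcon
      exact absurd (hr2 ⟨hz, hcon⟩) (not_le.2 hzr)
    have h2 : h (γ₀ + 1) - 1 < z := by
      by_contra! hcon
      exact absurd (hl2 ⟨hz, hcon⟩) (not_le.2 hlz)
    obtain ⟨w, hw, hwz⟩ := hXγ hz
    obtain ⟨i, hi⟩ := circ_coe_eq_coe_iff.1 hwz.symm
    have h3 : (0 : ℝ) < i := by linarith [hw.1]
    have h4 : (i : ℝ) < 1 := by linarith [hw.2]
    have h3' : 0 < i := by exact_mod_cast h3
    have h4' : i < 1 := by exact_mod_cast h4
    omega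
  have hγ₁ : h (g (l + 1) - 1 + 1) = l + 1 := by rw [sub_add_cancel, H.h_g]
  have hγ₁₀ : g (l + 1) - 1 ≤ γ₀ := by
    have : g (l + 1) ≤ g (h (γ₀ + 1)) := H.strictMono_g.monotone (by linarith)
    rw [H.g_h] at this
    linarith
  have hγ₂₀ : γ₀ ≤ g r := by
    have := H.strictMono_g.monotone hr1
    rwa [H.g_h] at this
  refine ⟨g (l + 1) - 1, g r, hγ₁₀.trans hγ₂₀, ?_, ?_, fun γ hγ x hx => ?_⟩
  · rw [hγ₁, circ_coe_add_one]
    exact hlP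
  · rw [H.h_g]
    exact hrP
  · obtain ⟨z, rfl⟩ := circ_exists_coe x
    have h1 : h γ ≤ r := by
      have := H.strictMono_h.monotone hγ.2
      rwa [H.h_g] at this
    have h2 : l + 1 ≤ h (γ + 1) := by
      rw [← hγ₁]
      exact H.strictMono_h.monotone (by linarith [hγ.1])
    obtain ⟨i, hi1, hi2⟩ := circ_exists_mem_Ico (h γ) z
    refine ⟨z + i, ⟨hi1, ?_⟩, circ_coe_add_int _ _⟩
    by_contra! hcon
    refine hgap _ (hP z hx (i - 1)) ?_ ?_ <;> push_cast <;> linarith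

/-- If `X ⊆ T '' X` lies in the arc of parameter `γ`, then each point of `X` has a preimage in `X`
on that arc. -/
theorem exists_preimage_mem (H : ExpandingLift T g h K k) {X : Set Circ} (hXT : X ⊆ T '' X) {γ : ℝ}
    (hXγ : X ⊆ (fun x : ℝ => (x : Circ)) '' Set.Icc (h γ) (h (γ + 1))) {x : ℝ}
    (hx : (x : Circ) ∈ X) :
    ∃ n : ℤ, x + n ∈ Set.Icc γ (γ + 1) ∧ (h (x + n) : Circ) ∈ X := by
  obtain ⟨p, hp, hpx⟩ := hXT hx
  obtain ⟨y, hy, rfl⟩ := hXγ hp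
  simp only at hpx hp
  rw [← H.coe_g] at hpx
  obtain ⟨n, hn⟩ := circ_coe_eq_coe_iff.1 hpx.symm
  refine ⟨n, ?_, ?_⟩
  · rw [← hn]
    have h1 := H.strictMono_g.monotone hy.1
    have h2 := H.strictMono_g.monotone hy.2
    rw [H.g_h] at h1 h2
    exact ⟨h1, h2⟩
  · rwa [← hn, H.h_g]

/-- The translate of `x` lying in `[γ, γ + 1]` is `x` itself unless `x = γ`, where it could be `γ +
1`; the hypothesis on the end point settles that case. -/
theorem h_mem_of_mem_Ico (H : ExpandingLift T g h K k) {X : Set Circ} (hXT : X ⊆ T '' X) {γ : ℝ}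
    (hXγ : X ⊆ (fun x : ℝ => (x : Circ)) '' Set.Icc (h γ) (h (γ + 1)))
    (hγ : (h γ : Circ) ∈ X) {x : ℝ} (hx : (x : Circ) ∈ X) (h1 : γ ≤ x) (h2 : x < γ + 1) :
    (h x : Circ) ∈ X := by
  obtain ⟨n, hn, hnX⟩ := H.exists_preimage_mem hXT hXγ hx
  have h3 : (-1 : ℝ) < n := by linarith [hn.1]
  have h3' : -1 < n := by exact_mod_cast h3
  rcases (show 0 ≤ n by omega).eq_or_lt with h0 | hpos
  · simpa [← h0] using hnX
  · have h4 : (1 : ℝ) ≤ n := by exact_mod_cast hpos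
    have : x = γ := by linarith [hn.2]
    rwa [this]

theorem h_mem_of_mem_Ioc (H : ExpandingLift T g h K k) {X : Set Circ} (hXT : X ⊆ T '' X) {γ : ℝ}
    (hXγ : X ⊆ (fun x : ℝ => (x : Circ)) '' Set.Icc (h γ) (h (γ + 1)))
    (hγ : (h (γ + 1) : Circ) ∈ X) {x : ℝ} (hx : (x : Circ) ∈ X) (h1 : γ < x) (h2 : x ≤ γ + 1) :
    (h x : Circ) ∈ X := by
  obtain ⟨n, hn, hnX⟩ := H.exists_preimage_mem hXT hXγ hx
  have h3 : (n : ℝ) < 1 := by linarith [hn.2]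
  have h3' : n < 1 := by exact_mod_cast h3
  rcases (show n ≤ 0 by omega).eq_or_lt with h0 | hneg
  · simpa [h0] using hnX
  · have h4 : (n : ℝ) ≤ -1 := by exact_mod_cast (show n ≤ -1 by omega)
    have : x = γ + 1 := by linarith [hn.1]
    rwa [this]

end ExpandingLift

theorem mainTheorem3 (T : Circ → Circ) (hT : IsExpanding T) (hTor : IsOrientationPreserving T)
    (hTLip : IsLip T) (f : Circ → ℝ) (hf : IsLip f) (S : Measure Circ)
    (hS : IsSturmian T S) (hmax : IsMaximizing T f S) :
    ∃ F : Set Circ, IsFlower T 1 F ∧ Carries F S ∧ CanBeLipschitzFlattened T f F := by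
  obtain ⟨g, h, K, k, H⟩ := exists_expandingLift hT hTor hTLip
  have hTc := hT.1
  obtain ⟨⟨hprob, hinv⟩, F₀, hF₀, hF₀S⟩ := hS
  obtain ⟨α, A, Φ, hΦ, hA, hle, hzero, hlip⟩ := H.exists_normal_form hTc hf hmax
  obtain ⟨γ₀, hγ₀⟩ := H.exists_subset_arc hF₀
  set X := S.support with hX
  have hTX : ∀ x ∈ X, T x ∈ X := fun x hx => map_mem_support hTc hinv hx
  have hXT : X ⊆ T '' X := support_subset_image hTc hinv
  obtain ⟨γ₁, γ₂, hγ, hγ₁X, hγ₂X, harc⟩ := H.exists_arc_range Measure.isClosed_support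
    (Measure.nonempty_support hprob.ne_zero) (hF₀S.trans hγ₀)
  set F : ℝ → ℝ := fun x => f x - α + Φ x - Φ (T x) with hF
  have hFc : Continuous F := by
    have h1 := hf.continuous
    have h2 := hΦ.continuous
    have h3 : Continuous fun x : Circ => f x - α + Φ x - Φ (T x) := by fun_prop
    exact h3.comp circ_continuous_coe
  have hL : 0 ≤ A / (K - 1) := div_nonneg hA (sub_pos.2 H.one_lt).le
  have hex := exists_isQuasiSolution H.one_lt H.abs_h_sub_le hA hlip
  have hP : ∀ x ∈ {x : ℝ | (x : Circ) ∈ X}, ∀ n : ℤ, x + n ∈ {x : ℝ | (x : Circ) ∈ X} :=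
    fun x hx n => by
      change ((x + n : ℝ) : Circ) ∈ X
      rw [circ_coe_add_int]
      exact hx
  -- At `γ₁` the right end of the arc is in `X`, so the left-continuous branch preserves `X`; at
  -- `γ₂` the roles are exchanged. Forward invariance of `X` puts the cut point itself in `X`.
  obtain ⟨γ, hγmem, φ, hφ, hφ1⟩ := exists_periodic_solution hγ hex
    (by
      obtain ⟨φ, hφ⟩ := hex γ₁
      refine ⟨φ, hφ, hφ.one_nonneg hFc H.continuous_h H.one_lt hL H.strictMono_h.monotone
        H.abs_h_sub_le (fun x => hle _) (P := {x : ℝ | (x : Circ) ∈ X}) (fun x hx => hzero _ hx)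
        hP ?_ fun x hx h1 h2 => H.h_mem_of_mem_Ioc hXT (harc _ ⟨le_rfl, hγ⟩) hγ₁X hx h1 h2⟩
      have := hTX _ hγ₁X
      rwa [H.T_coe_h] at this)
    (by
      obtain ⟨φ, hφ⟩ := hex γ₂
      refine ⟨φ, hφ, hφ.one_nonpos hFc H.continuous_h H.one_lt hL H.strictMono_h.monotone
        H.abs_h_sub_le (fun x => hle _) (P := {x : ℝ | (x : Circ) ∈ X}) (fun x hx => hzero _ hx)
        hP ?_ fun x hx h1 h2 => H.h_mem_of_mem_Ico hXT (harc _ ⟨hγ, le_rfl⟩) hγ₂X hx h1 h2⟩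
      have := hTX _ hγ₂X
      rwa [H.T_coe_h] at this)
  obtain ⟨Ψ, ⟨C₂, hC₂⟩, hΨφ⟩ := exists_circ_lift (fun x => by rw [hφ.add_one, hφ1, add_zero])
    hφ.abs_sub_le
  obtain ⟨C₁, hC₁⟩ := hΦ
  -- The constant is read off from the flattening equation at the base point `γ`, with `α` restored.
  refine ⟨_, H.isFlower_arc γ, harc γ hγmem, fun x => Φ x + Ψ x, ⟨C₁ + C₂, hC₁.add hC₂⟩,
    α - (φ γ - F (h γ) - φ (h γ)), ?_⟩
  rintro _ ⟨y, hy, rfl⟩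
  have h1 := H.strictMono_g.monotone hy.1
  have h2 := H.strictMono_g.monotone hy.2
  rw [H.g_h] at h1 h2
  have h3 := hφ.sub_eq_of_mem_Icc hFc H.continuous_h (x := γ) (y := g y)
    ⟨le_rfl, by linarith⟩ ⟨h1, h2⟩
  rw [H.h_g] at h3
  have h4 : F y = f y - α + Φ y - Φ (T y) := rfl
  simp only
  rw [← hΨφ (g y), ← hΨφ y, H.coe_g] at h3
  linarith
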